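/- Let $n,m\in\mathbb{Z}^+$ and $\beta,\nu,\sigma\in\mathbb{C}$ with $n+\sigma-\nu=m$. Assume $\nu\neq n$, $\sigma\notin\{0,-1,-2,\dots\}$, $\beta\notin\{n-1,n-2,n-3,\dots\}$ and $\beta+\sigma\notin\{0,-1,-2,\dots\}$ (the first three conditions hold in particular whenever $\nu\notin\mathbb{Z}$ and $\beta\notin\mathbb{Z}$). Write $(a)_k=a(a+1)\cdots(a+k-1)$, $\psi=\Gamma'/\Gamma$, $1/\Gamma(-j)=0$ for $j=0,1,2,\dots$, and let empty sums be zero. Let ${}_3F_2(\beta,\nu,1;\beta+\sigma,n;z)$ denote the principal branch, i.e. the analytic continuation of $\sum_{k\ge0}\frac{(\beta)_k(\nu)_k(1)_k}{(\beta+\sigma)_k(n)_k}\frac{z^k}{k!}$ from $0$ to $z$ along the segment $[0,z]$, $z\notin[1,\infty)$, and let $\log$ and $\arg$ be principal. Then for all $z\neq1$ with $|1-z|<1$ and $|\arg(1-z)|<\pi$ this continuation exists, the infinite series below converges absolutely, and $$ \begin{aligned} &\frac{\Gamma(\beta)\,(\nu-n)_n}{\Gamma(\beta+\sigma)\,(\nu-n)\,(n-1)!}\,z^{n-1}\,{}_3F_2(\beta,\nu,1;\beta+\sigma,n;z)\\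 &\quad=\frac{1}{\Gamma(\sigma)\Gamma(\beta+\sigma-\nu)}\sum_{k=0}^{m-2}\frac{(-1)^k}{k!}\,\Gamma(k+\beta-n+1)\,(1+\nu-n)_k\,(m-2-k)!\,(1-z)^k\\ &\qquad+\frac{(-1)^m}{\Gamma(\nu-n+1)}(1-z)^{m-1}\sum_{k=0}^{\infty}\frac{(\sigma)_k(\beta+\sigma-\nu)_k}{(k+m-1)!\,k!}(1-z)^k\\ &\qquad\quad\times\bigl[\log(1-z)-\psi(\sigma-\nu+n+k)+\psi(\sigma+k)+\psi(k+\beta+\sigma-\nu)-\psi(k+1)\bigr]\\ &\qquad-\sum_{l=0}^{n-2}\left[\sum_{k=l}^{n-2}\frac{(\nu-n+1)_k\,\Gamma(k-n+\beta+1)}{\Gamma(k-n+\beta+\sigma+1)\,(k-l)!}\right]\frac{(z-1)^l}{l!}. \end{aligned} $$ In particular, eliminating $\sigma=m-n+\nu$, $$ \begin{aligned} &\frac{\Gamma(\beta)\,(\nu-n)_n}{\Gamma(\beta+m-n+\nu)\,(\nu-n)\,(n-1)!}\,z^{n-1}\,{}_3F_2(\beta,\nu,1;\beta+m-n+\nu,n;z)\\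 &\quad=\frac{1}{\Gamma(m-n+\nu)\Gamma(\beta+m-n)}\sum_{k=0}^{m-2}\frac{(-1)^k}{k!}\,\Gamma(k+\beta-n+1)\,(1+\nu-n)_k\,(m-2-k)!\,(1-z)^k\\ &\qquad+\frac{(-1)^m}{\Gamma(\nu-n+1)}(1-z)^{m-1}\sum_{k=0}^{\infty}\frac{(m-n+\nu)_k(\beta+m-n)_k}{(k+m-1)!\,k!}(1-z)^k\\ &\qquad\quad\times\bigl[\log(1-z)-\psi(m+k)+\psi(m-n+\nu+k)+\psi(k+\beta+m-n)-\psi(k+1)\bigr]\\ &\qquad-\sum_{l=0}^{n-2}\left[\sum_{k=l}^{n-2}\frac{(\nu-n+1)_k\,\Gamma(k-n+\beta+1)}{\Gamma(k-2n+\beta+m+\nu+1)\,(k-l)!}\right]\frac{(z-1)^l}{l!}. \end{aligned} $$ -/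

import Mathlib

open Complex Topology

noncomputable section

/-- The Pochhammer symbol (rising factorial) `(a)_k = a (a + 1) ⋯ (a + k - 1)`. -/
def poch (a : ℂ) (k : ℕ) : ℂ := (ascPochhammer ℂ k).eval a

/-- The hypergeometric series
`∑ k, (a₁)_k (a₂)_k (a₃)_k / ((b₁)_k (b₂)_k) * z ^ k / k!`, which for `b₁, b₂ ∉ {0, -1, -2, …}`
converges (absolutely) for `‖z‖ < 1`. -/
def hyp3F2Series (a₁ a₂ a₃ b₁ b₂ z : ℂ) : ℂ :=
  ∑' k : ℕ, poch a₁ k * poch a₂ k * poch a₃ k / (poch b₁ k * poch b₂ k) * z ^ k / (k.factorial : ℂ)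

/-- `F` continues the hypergeometric series `₃F₂(a₁, a₂, a₃; b₁, b₂; ·)` analytically from the
origin along the straight segment `[0, z]`. -/
def ContinuesHyp3F2 (a₁ a₂ a₃ b₁ b₂ z : ℂ) (F : ℂ → ℂ) : Prop :=
  AnalyticOnNhd ℂ F (segment ℝ 0 z) ∧ F =ᶠ[𝓝 0] hyp3F2Series a₁ a₂ a₃ b₁ b₂

open Classical in
/-- The principal branch of the generalized hypergeometric function `₃F₂(a₁, a₂, a₃; b₁, b₂; z)`:
the analytic continuation of the series from the origin to `z` along the segment `[0, z]`.
Since the cut plane `ℂ ∖ [1, ∞)` is star-shaped about `0`, this is the branch that is analytic on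
that cut plane. The value is `0` (junk) if there is no continuation along the segment. -/
def hyp3F2 (a₁ a₂ a₃ b₁ b₂ z : ℂ) : ℂ :=
  if h : ∃ F, ContinuesHyp3F2 a₁ a₂ a₃ b₁ b₂ z F then h.choose z else 0

/-- The value does not depend on the continuation chosen. -/
theorem hyp3F2_eq_of_continues {a₁ a₂ a₃ b₁ b₂ z : ℂ} {F : ℂ → ℂ}
    (hF : ContinuesHyp3F2 a₁ a₂ a₃ b₁ b₂ z F) : hyp3F2 a₁ a₂ a₃ b₁ b₂ z = F z := by
  have h : ∃ F, ContinuesHyp3F2 a₁ a₂ a₃ b₁ b₂ z F := ⟨F, hF⟩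
  rw [hyp3F2, dif_pos h]
  exact h.choose_spec.1.eqOn_of_preconnected_of_eventuallyEq hF.1
    (convex_segment (𝕜 := ℝ) (0 : ℂ) z).isPreconnected (left_mem_segment ℝ 0 z)
    (h.choose_spec.2.trans hF.2.symm) (right_mem_segment ℝ 0 z)

end

/-! Put `N = n - 1`, `M = m - 1`, `a = ν - N`, `b = β - N` and `c = a + b + M = β + σ - N`. A shift
of the summation index by `N` shows that the left side is the regularised Gauss series `∑ (a)_k
Γ(b+k) / (Γ(c+k) k!) z^k` with its first `N` terms removed (`gaussCoef_add`). Those terms,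
re-expanded about `1`, form the last sum on the right (`sum_gaussCoef_eq`). What remains is the
logarithmic connection formula for `c - a - b = M` (`connection_formula`).

That formula is proved by induction on `M`. Differentiation in `w = 1 - z` turns both sides into
`-a` times the same objects for `(a+1, b+1, M-1)`, so they differ by a constant. The constant is
found at `w = 0` from Gauss's summation theorem and Abel's limit theorem. For `M = 0`, a nonzero
multiple of the difference of the two sides solves the hypergeometric equation in `w`. It tends to
`0` at `w = 0`, and so does `w` times its derivative, so a Wronskian argument makes it vanish
(`eq_zero_of_hypergeometric_ode`). The limit needed there is `logAsymptotic`, obtained from Euler's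
integral and Gauss's integral for the digamma function.

The expansion about `1` also continues the Gauss function. The `₃F₂` inherits the continuation after
division by `(a)_N`, unless `(a)_N = 0`. In that case `ν` is an integer between `1` and `N`, the
coefficients are rational in `k` with simple poles, and partial fractions reduce the series to sums
of `z^k / (s + k)`, which are Gauss functions again. The identity theorem carries the formula along
`[0, z]`. -/

/-! ### Power series of radius at least one. -/

/-- Sequences of subexponential growth: power series coefficients of radius at least one. -/
def SubExp (c : ℕ → ℂ) : Prop := ∀ r : ℝ, 0 < r → r < 1 → ∃ C : ℝ, ∀ k, ‖c k‖ * r ^ k ≤ C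

/-- The sum of the power series with coefficients `c`. -/
noncomputable def ps (c : ℕ → ℂ) (z : ℂ) : ℂ := ∑' k, c k * z ^ k

namespace SubExp

variable {c d : ℕ → ℂ}

theorem summable_norm (hc : SubExp c) {z : ℂ} (hz : ‖z‖ < 1) :
    Summable fun k => ‖c k * z ^ k‖ := by
  obtain ⟨r, hr, hr1⟩ := exists_between hz
  have hr0 : 0 < r := (norm_nonneg z).trans_lt hr
  obtain ⟨C, hC⟩ := hc r hr0 hr1
  refine Summable.of_nonneg_of_le (fun k => norm_nonneg _) (fun k => ?_)
    ((summable_geometric_of_lt_one (r := ‖z‖ / r) (by positivity)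
      ((div_lt_one hr0).2 hr)).mul_left C)
  rw [norm_mul, norm_pow, div_pow, ← mul_div_assoc, le_div_iff₀ (by positivity)]
  nlinarith [hC k, pow_nonneg (norm_nonneg z) k]

theorem summable (hc : SubExp c) {z : ℂ} (hz : ‖z‖ < 1) : Summable fun k => c k * z ^ k :=
  (hc.summable_norm hz).of_norm

theorem hasSum (hc : SubExp c) {z : ℂ} (hz : ‖z‖ < 1) :
    HasSum (fun k => c k * z ^ k) (ps c z) := (hc.summable hz).hasSum

/-- Write `r ^ k = √r ^ k * √r ^ k` and give one factor to each sequence; `√r` is still below `1`.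
-/
theorem mul (hc : SubExp c) (hd : SubExp d) : SubExp fun k => c k * d k := by
  intro r h0 h1
  have hs0 : 0 < √r := Real.sqrt_pos.2 h0
  have hs1 : √r < 1 := by rw [Real.sqrt_lt' one_pos]; simpa using h1
  obtain ⟨C, hC⟩ := hc _ hs0 hs1
  obtain ⟨D, hD⟩ := hd _ hs0 hs1
  refine ⟨C * D, fun k => ?_⟩
  have : r ^ k = √r ^ k * √r ^ k := by rw [← mul_pow, Real.mul_self_sqrt h0.le]
  rw [norm_mul, this, mul_mul_mul_comm]
  exact mul_le_mul (hC k) (hD k) (by positivity) (le_trans (by positivity) (hC k))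

theorem add (hc : SubExp c) (hd : SubExp d) : SubExp fun k => c k + d k := by
  intro r h0 h1
  obtain ⟨C, hC⟩ := hc _ h0 h1
  obtain ⟨D, hD⟩ := hd _ h0 h1
  refine ⟨C + D, fun k => ?_⟩
  calc _ ≤ (‖c k‖ + ‖d k‖) * r ^ k := by gcongr; exact norm_add_le _ _
    _ ≤ _ := by rw [add_mul]; exact add_le_add (hC k) (hD k)

theorem const (a : ℂ) : SubExp fun _ => a := fun _ h0 h1 =>
  ⟨‖a‖, fun _ => mul_le_of_le_one_right (norm_nonneg _) (pow_le_one₀ h0.le h1.le)⟩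

theorem neg (hc : SubExp c) : SubExp fun k => - c k := by
  simpa [SubExp] using hc

theorem sub (hc : SubExp c) (hd : SubExp d) : SubExp fun k => c k - d k := by
  simpa [sub_eq_add_neg] using hc.add hd.neg

theorem const_mul (hc : SubExp c) (a : ℂ) : SubExp fun k => a * c k := (const a).mul hc

theorem shift (hc : SubExp c) : SubExp fun k => c (k + 1) := by
  intro r h0 h1
  obtain ⟨C, hC⟩ := hc r h0 h1
  refine ⟨C / r, fun k => ?_⟩
  rw [le_div_iff₀ h0, mul_assoc, ← pow_succ]
  exact hC (k + 1)

theorem of_eventually_le (h : ∀ r : ℝ, 0 < r → r < 1 → ∃ N, ∀ k ≥ N, ‖c (k + 1)‖ * r ≤ ‖c k‖) :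
    SubExp c := by
  intro r h0 h1
  obtain ⟨N, hN⟩ := h r h0 h1
  have key : ∀ k, ‖c (N + k)‖ * r ^ (N + k) ≤ ‖c N‖ * r ^ N := by
    intro k
    induction k with
    | zero => simp
    | succ k ih =>
      refine le_trans ?_ ih
      have := hN (N + k) (by omega)
      rw [← add_assoc, pow_succ, mul_comm (r ^ (N + k)), ← mul_assoc]
      gcongr
  refine ⟨∑ i ∈ Finset.range (N + 1), ‖c i‖ * r ^ i, fun k => ?_⟩
  by_cases hk : k ≤ N
  · exact Finset.single_le_sum (f := fun i => ‖c i‖ * r ^ i) (fun i _ => by positivity)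
      (Finset.mem_range.2 (by omega))
  · obtain ⟨j, rfl⟩ := Nat.exists_eq_add_of_le (not_le.1 hk).le
    exact (key j).trans (Finset.single_le_sum (f := fun i => ‖c i‖ * r ^ i)
      (fun i _ => by positivity) (Finset.mem_range.2 (by omega)))

theorem of_ratio {ρ : ℕ → ℂ} (hρ : Filter.Tendsto ρ Filter.atTop (𝓝 1))
    (h : ∀ᶠ k in Filter.atTop, c (k + 1) = ρ k * c k) : SubExp c := by
  refine of_eventually_le fun r h0 h1 => ?_
  have h2 : ∀ᶠ k in Filter.atTop, ‖ρ k‖ < r⁻¹ := by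
    have := hρ.norm
    rw [norm_one] at this
    exact this.eventually_lt_const ((one_lt_inv₀ h0).2 h1)
  obtain ⟨N, hN⟩ := Filter.eventually_atTop.1 (h.and h2)
  refine ⟨N, fun k hk => ?_⟩
  obtain ⟨e, l⟩ := hN k hk
  rw [e, norm_mul, mul_right_comm]
  refine mul_le_of_le_one_left (norm_nonneg _) ?_
  calc ‖ρ k‖ * r ≤ r⁻¹ * r := by gcongr
    _ = 1 := inv_mul_cancel₀ h0.ne'

theorem tendsto_add_div_add (a b : ℂ) :
    Filter.Tendsto (fun k : ℕ => (a + k) / (b + k)) Filter.atTop (𝓝 1) := by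
  have h1 : ∀ s : ℂ, Filter.Tendsto (fun k : ℕ => s / k + 1) Filter.atTop (𝓝 1) := fun s => by
    simpa using (tendsto_const_div_atTop_nhds_zero_nat s).add_const 1
  have := (h1 a).div (h1 b) one_ne_zero
  rw [div_one] at this
  refine this.congr' ?_
  filter_upwards [Filter.eventually_ne_atTop 0] with k hk
  have hk' : (k : ℂ) ≠ 0 := Nat.cast_ne_zero.2 hk
  rw [Pi.div_apply, div_add_one hk', div_add_one hk', div_div_div_cancel_right₀ hk']

theorem natCast : SubExp fun k => (k : ℂ) := by
  refine of_ratio (tendsto_add_div_add 1 0) ?_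
  filter_upwards [Filter.eventually_ne_atTop 0] with k hk
  have hk' : (k : ℂ) ≠ 0 := Nat.cast_ne_zero.2 hk
  push_cast
  rw [zero_add, div_mul_cancel₀ _ hk', add_comm]

/-- Bounded increments force at most linear growth. -/
theorem of_bounded_diff (C : ℝ) (h : ∀ k, ‖c (k + 1) - c k‖ ≤ C) : SubExp c := by
  have key : ∀ k : ℕ, ‖c k‖ ≤ ‖c 0‖ + k * C := by
    intro k
    induction k with
    | zero => simp
    | succ k ih =>
      have := norm_add_le (c (k + 1) - c k) (c k)
      rw [sub_add_cancel] at this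
      push_cast
      linarith [h k]
  have hC : 0 ≤ C := (norm_nonneg _).trans (h 0)
  have h2 : SubExp fun k => (‖c 0‖ : ℂ) + k * (C : ℂ) := (const _).add (natCast.mul (const _))
  intro r h0 h1
  obtain ⟨D, hD⟩ := h2 r h0 h1
  refine ⟨D, fun k => le_trans ?_ (hD k)⟩
  gcongr
  refine (key k).trans (le_of_eq ?_)
  simp only []
  rw [show (‖c 0‖ : ℂ) + k * (C : ℂ) = ((‖c 0‖ + k * C : ℝ) : ℂ) by push_cast; ring,
    Complex.norm_of_nonneg (by positivity)]

end SubExp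

/-- The coefficients of the derivative of a power series. -/
def dcoef (c : ℕ → ℂ) (k : ℕ) : ℂ := (k + 1) * c (k + 1)

theorem SubExp.dcoef {c : ℕ → ℂ} (hc : SubExp c) : SubExp (dcoef c) :=
  (natCast.add (const 1)).mul hc.shift

theorem SubExp.hasDerivAt {c : ℕ → ℂ} (hc : SubExp c) {z : ℂ} (hz : ‖z‖ < 1) :
    HasDerivAt (ps c) (ps (_root_.dcoef c) z) z := by
  obtain ⟨r, hr, hr1⟩ := exists_between hz
  have hr0 : 0 < r := (norm_nonneg z).trans_lt hr
  have hkc := natCast.mul hc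
  have hs : Summable fun k : ℕ => r⁻¹ * ‖(k : ℂ) * c k * (r : ℂ) ^ k‖ :=
    (hkc.summable_norm (by rwa [Complex.norm_of_nonneg hr0.le])).mul_left _
  have hs' : ∀ (k : ℕ) (y : ℂ), y ∈ Metric.ball (0 : ℂ) r →
      ‖c k * (k * y ^ (k - 1))‖ ≤ r⁻¹ * ‖(k : ℂ) * c k * (r : ℂ) ^ k‖ := by
    intro k y hy
    rw [mem_ball_zero_iff] at hy
    rcases k with _ | k
    · simp
    · have e : r⁻¹ * ‖((k + 1 : ℕ) : ℂ) * c (k + 1) * (r : ℂ) ^ (k + 1)‖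
          = ‖c (k + 1)‖ * (‖((k + 1 : ℕ) : ℂ)‖ * r ^ k) := by
        rw [norm_mul, norm_mul, norm_pow, Complex.norm_of_nonneg hr0.le, pow_succ]
        field_simp
      rw [e, norm_mul, norm_mul, norm_pow, Nat.add_sub_cancel]
      gcongr
  have h := hasDerivAt_tsum_of_isPreconnected (𝕜 := ℂ) (g := fun k y => c k * y ^ k)
    (g' := fun k y => c k * (k * y ^ (k - 1))) hs Metric.isOpen_ball
    (convex_ball (0 : ℂ) r).isPreconnected
    (fun k y _ => (hasDerivAt_pow k y).const_mul (c k)) hs'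
    (Metric.mem_ball_self hr0) (hc.summable (by simp)) (mem_ball_zero_iff.2 hr)
  refine h.congr_deriv ?_
  rw [Summable.tsum_eq_zero_add (Summable.of_norm_bounded hs
    fun k => hs' k z (mem_ball_zero_iff.2 hr))]
  simp only [CharP.cast_eq_zero, zero_mul, mul_zero, zero_add, Nat.add_sub_cancel, ps]
  refine tsum_congr fun k => ?_
  simp only [_root_.dcoef]
  push_cast
  ring

theorem SubExp.differentiableOn {c : ℕ → ℂ} (hc : SubExp c) :
    DifferentiableOn ℂ (ps c) (Metric.ball 0 1) := fun _ hz =>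
  (hc.hasDerivAt (mem_ball_zero_iff.1 hz)).differentiableAt.differentiableWithinAt

theorem SubExp.tendsto_zero {c : ℕ → ℂ} (hc : SubExp c) :
    Filter.Tendsto (ps c) (𝓝 0) (𝓝 (c 0)) := by
  have h := (hc.hasDerivAt (z := 0) (by simp)).continuousAt.tendsto
  have e : ps c 0 = c 0 := by
    rw [ps, tsum_eq_single 0 (fun k hk => by simp [hk])]
    simp
  rwa [e] at h

theorem ps_const_mul (a : ℂ) (c : ℕ → ℂ) (z : ℂ) : ps (fun k => a * c k) z = a * ps c z := by
  simp only [ps, mul_assoc, tsum_mul_left]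

theorem SubExp.ps_add {c d : ℕ → ℂ} (hc : SubExp c) (hd : SubExp d) {z : ℂ} (hz : ‖z‖ < 1) :
    ps (fun k => c k + d k) z = ps c z + ps d z := by
  simp only [ps, add_mul]
  exact (hc.summable hz).tsum_add (hd.summable hz)

theorem SubExp.ps_sub {c d : ℕ → ℂ} (hc : SubExp c) (hd : SubExp d) {z : ℂ} (hz : ‖z‖ < 1) :
    ps (fun k => c k - d k) z = ps c z - ps d z := by
  simp only [ps, sub_mul]
  exact (hc.summable hz).tsum_sub (hd.summable hz)

theorem SubExp.ps_eq_add {c : ℕ → ℂ} (hc : SubExp c) {z : ℂ} (hz : ‖z‖ < 1) :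
    ps c z = c 0 + z * ps (fun k => c (k + 1)) z := by
  rw [ps, (hc.summable hz).tsum_eq_zero_add, ps, ← tsum_mul_left]
  congr 1
  · simp
  · exact tsum_congr fun k => by ring

/-- The series of `z f'(z)`. -/
theorem SubExp.hasSum_mul_deriv {c : ℕ → ℂ} (hc : SubExp c) {z : ℂ} (hz : ‖z‖ < 1) :
    HasSum (fun k : ℕ => k * c k * z ^ k) (z * ps (_root_.dcoef c) z) := by
  rw [← hasSum_nat_add_iff' 1]
  simp only [Finset.range_one, Finset.sum_singleton, CharP.cast_eq_zero, zero_mul, sub_zero]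
  refine ((hc.dcoef.hasSum hz).mul_left z).congr_fun ?_
  intro k
  simp only [_root_.dcoef]
  push_cast
  ring

/-! ### Poles of the Gamma function and Pochhammer symbols. -/

/-- `s` is not a pole of the Gamma function. -/
def NotPole (s : ℂ) : Prop := ∀ j : ℕ, s ≠ -(j : ℂ)

namespace NotPole

variable {s : ℂ}

theorem ne_zero (h : NotPole s) : s ≠ 0 := by simpa using h 0

theorem add_natCast (h : NotPole s) (k : ℕ) : NotPole (s + k) := fun j e =>
  h (k + j) (by push_cast; linear_combination e)

theorem add_one (h : NotPole s) : NotPole (s + 1) := by simpa using h.add_natCast 1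

theorem add_natCast_ne_zero (h : NotPole s) (k : ℕ) : s + k ≠ 0 := (h.add_natCast k).ne_zero

theorem Gamma_ne_zero (h : NotPole s) : Gamma s ≠ 0 := Complex.Gamma_ne_zero h

theorem of_re_pos (h : 0 < s.re) : NotPole s := fun j e => by
  rw [e] at h
  simp only [neg_re, natCast_re, Left.neg_pos_iff] at h
  exact absurd h (not_lt.2 j.cast_nonneg)

theorem natCast_add_one (k : ℕ) : NotPole ((k : ℂ) + 1) :=
  of_re_pos (by simp only [add_re, natCast_re, one_re]; positivity)

theorem one : NotPole 1 := of_re_pos (by simp)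

theorem exists_add_natCast (s : ℂ) : ∃ k : ℕ, NotPole (s + k) := by
  obtain ⟨k, hk⟩ := exists_nat_gt (-s.re)
  exact ⟨k, of_re_pos (by simp only [add_re, natCast_re]; linarith)⟩

end NotPole

theorem poch_zero (a : ℂ) : poch a 0 = 1 := by simp [poch]

theorem poch_succ (a : ℂ) (k : ℕ) : poch a (k + 1) = poch a k * (a + k) :=
  ascPochhammer_succ_eval k a

theorem poch_succ_left (a : ℂ) (k : ℕ) : poch a (k + 1) = a * poch (a + 1) k := by
  induction k with
  | zero => simp [poch_succ, poch_zero]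
  | succ k ih =>
    rw [poch_succ, ih, poch_succ (a + 1)]
    push_cast
    ring

theorem poch_add (a : ℂ) (j k : ℕ) : poch a (j + k) = poch a j * poch (a + j) k := by
  induction k with
  | zero => simp [poch_zero]
  | succ k ih =>
    rw [← add_assoc, poch_succ, ih, poch_succ (a + j)]
    push_cast
    ring

theorem poch_eq_prod (a : ℂ) (k : ℕ) : poch a k = ∏ j ∈ Finset.range k, (a + j) := by
  induction k with
  | zero => simp [poch_zero]
  | succ k ih => rw [poch_succ, ih, Finset.prod_range_succ]

theorem poch_one (k : ℕ) : poch 1 k = k.factorial := by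
  induction k with
  | zero => simp [poch_zero]
  | succ k ih =>
    rw [poch_succ, ih, Nat.factorial_succ]
    push_cast
    ring

theorem NotPole.poch_ne_zero {a : ℂ} (h : NotPole a) (k : ℕ) : poch a k ≠ 0 := by
  rw [poch_eq_prod]
  exact Finset.prod_ne_zero_iff.2 fun j _ => h.add_natCast_ne_zero j

theorem NotPole.Gamma_add_natCast {a : ℂ} (h : NotPole a) (k : ℕ) :
    Gamma (a + k) = poch a k * Gamma a := by
  induction k with
  | zero => simp [poch_zero]
  | succ k ih =>
    rw [poch_succ, Nat.cast_succ, ← add_assoc, Gamma_add_one _ (h.add_natCast_ne_zero k), ih]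
    ring

theorem inv_Gamma_eq (s : ℂ) : (Gamma s)⁻¹ = s * (Gamma (s + 1))⁻¹ :=
  one_div_Gamma_eq_self_mul_one_div_Gamma_add_one s

theorem cast_factorial_ne_zero (k : ℕ) : (k.factorial : ℂ) ≠ 0 :=
  Nat.cast_ne_zero.2 k.factorial_ne_zero

/-! ### Gauss coefficients, their asymptotics and Gauss's summation theorem. -/

/-- The Taylor coefficients at the origin of the regularised Gauss function
`Γ(b) / Γ(c) * ₂F₁(a, b; c; z)`. -/
noncomputable def gaussCoef (a b c : ℂ) (k : ℕ) : ℂ :=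
  poch a k * Gamma (b + k) * (Gamma (c + k))⁻¹ / k.factorial

theorem gaussCoef_eq_mul (a b c : ℂ) (k : ℕ) :
    gaussCoef a b c k = (c + k) * gaussCoef a b (c + 1) k := by
  rw [gaussCoef, gaussCoef, inv_Gamma_eq (c + k), add_right_comm c 1]
  ring

theorem succ_mul_gaussCoef_succ (a c : ℂ) {b : ℂ} (hb : NotPole b) (k : ℕ) :
    (k + 1) * gaussCoef a b c (k + 1) = (a + k) * (b + k) * gaussCoef a b (c + 1) k := by
  have h1 : (k : ℂ) + 1 ≠ 0 := Nat.cast_add_one_ne_zero k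
  have h2 := cast_factorial_ne_zero k
  rw [gaussCoef, gaussCoef, poch_succ, Nat.factorial_succ, Nat.cast_mul, Nat.cast_succ,
    ← add_assoc b, Gamma_add_one _ (hb.add_natCast_ne_zero k), ← add_assoc c, add_right_comm c 1]
  field_simp

theorem gaussCoef_recurrence (a c : ℂ) {b : ℂ} (hb : NotPole b) (k : ℕ) :
    (k + 1) * (c + k) * gaussCoef a b c (k + 1) = (a + k) * (b + k) * gaussCoef a b c k := by
  rw [gaussCoef_eq_mul a b c k]
  linear_combination (c + k) * succ_mul_gaussCoef_succ a c hb k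

theorem dcoef_gaussCoef (a b c : ℂ) :
    dcoef (gaussCoef a b c) = fun k => a * gaussCoef (a + 1) (b + 1) (c + 1) k := by
  ext k
  have h1 : (k : ℂ) + 1 ≠ 0 := Nat.cast_add_one_ne_zero k
  have h2 := cast_factorial_ne_zero k
  simp only [dcoef, gaussCoef, poch_succ_left, Nat.factorial_succ]
  push_cast
  rw [add_right_comm b 1, add_assoc b, add_right_comm c 1, add_assoc c]
  field_simp

theorem subExp_gaussCoef (a c : ℂ) {b : ℂ} (hb : NotPole b) : SubExp (gaussCoef a b c) := by
  refine SubExp.of_ratio (ρ := fun k : ℕ => (a + k) / (1 + k) * ((b + k) / (c + k))) ?_ ?_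
  · simpa using (SubExp.tendsto_add_div_add a 1).mul (SubExp.tendsto_add_div_add b c)
  · obtain ⟨N, hN⟩ := NotPole.exists_add_natCast c
    filter_upwards [Filter.eventually_ge_atTop N] with k hk
    obtain ⟨j, rfl⟩ := Nat.exists_eq_add_of_le hk
    have h0 : c + (N + j : ℕ) ≠ 0 := by
      push_cast; rw [← add_assoc]; exact hN.add_natCast_ne_zero j
    have h1 : (1 : ℂ) + (N + j : ℕ) ≠ 0 := by rw [add_comm]; exact Nat.cast_add_one_ne_zero _
    have := gaussCoef_recurrence a c hb (N + j)
    field_simp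
    linear_combination this

theorem tendsto_poch_div (s : ℂ) :
    Filter.Tendsto (fun k : ℕ => poch s (k + 1) / ((k : ℂ) ^ s * k.factorial)) Filter.atTop
      (𝓝 (Gamma s)⁻¹) := by
  have e : ∀ k : ℕ, poch s (k + 1) / ((k : ℂ) ^ s * k.factorial) = (GammaSeq s k)⁻¹ := fun k => by
    rw [GammaSeq, poch_eq_prod, inv_div]
  simp only [e]
  by_cases h : NotPole s
  · exact (GammaSeq_tendsto_Gamma s).inv₀ h.Gamma_ne_zero
  -- At a pole the value `Gamma s = 0` has inverse `0`, in agreement with `(s)_{k+1} = 0` for `k ≥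
  -- j`.
  · obtain ⟨j, hj⟩ : ∃ j : ℕ, s = -(j : ℂ) := by simpa [NotPole] using h
    rw [(Gamma_eq_zero_iff s).2 ⟨j, hj⟩, inv_zero]
    refine tendsto_const_nhds.congr' ?_
    filter_upwards [Filter.eventually_ge_atTop j] with k hk
    rw [GammaSeq, Finset.prod_eq_zero (Finset.mem_range.2 (Nat.lt_succ_of_le hk)) (by simp [hj]),
      div_zero, inv_zero]

/-- Away from the poles this is Gauss's product for `Γ(s)`. The induction moves `s` to the right:
the terms for `s` and `s + 1` differ by the factor `(s + 1 + k) / k`, which tends to `1`. -/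
theorem tendsto_cpow_mul_inv_Gamma (s : ℂ) :
    Filter.Tendsto (fun k : ℕ => (k : ℂ) ^ s * k.factorial * (Gamma (s + k + 1))⁻¹) Filter.atTop
      (𝓝 1) := by
  obtain ⟨j, hj⟩ := NotPole.exists_add_natCast s
  induction j generalizing s with
  | zero =>
    rw [Nat.cast_zero, add_zero] at hj
    have h := (GammaSeq_tendsto_Gamma s).mul_const (Gamma s)⁻¹
    rw [mul_inv_cancel₀ hj.Gamma_ne_zero] at h
    refine h.congr fun k => ?_
    have := hj.Gamma_add_natCast (k + 1)
    push_cast at this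
    rw [add_assoc, this, GammaSeq, ← poch_eq_prod, mul_inv]
    ring
  | succ j ih =>
    have h := (ih (s + 1) (by convert hj using 1; push_cast; ring)).mul
      (SubExp.tendsto_add_div_add (s + 1) 0)
    rw [mul_one] at h
    refine h.congr' ?_
    filter_upwards [Filter.eventually_ne_atTop 0] with k hk
    have hk' : (k : ℂ) ≠ 0 := Nat.cast_ne_zero.2 hk
    rw [cpow_add _ _ hk', cpow_one, inv_Gamma_eq (s + k + 1), zero_add, add_right_comm s 1]
    field_simp

/-- The coefficient behaves like `k ^ (a + b - c - 1) / Γ(a)`, and the exponent is `-j` here. -/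
theorem tendsto_gaussCoef (a b : ℂ) (j : ℕ) :
    Filter.Tendsto (gaussCoef a b (a + b - 1 + j)) Filter.atTop
      (𝓝 (if j = 0 then (Gamma a)⁻¹ else 0)) := by
  have h1 := tendsto_poch_div a
  have h2 := (tendsto_cpow_mul_inv_Gamma (b - 1)).inv₀ one_ne_zero
  have h3 := tendsto_cpow_mul_inv_Gamma (a + b - 1 + j - 1)
  have h4 := SubExp.tendsto_add_div_add 0 a
  have h5 : Filter.Tendsto (fun k : ℕ => ((k : ℂ)⁻¹) ^ j) Filter.atTop
      (𝓝 (if j = 0 then 1 else 0)) := by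
    rcases j with _ | j
    · simp
    · have := (tendsto_inv_atTop_nhds_zero_nat (𝕜 := ℂ)).pow (j + 1)
      simpa using this
  have h := (((h1.mul h2).mul h3).mul h4).mul h5
  rw [inv_one, mul_one, mul_one, mul_one, mul_ite, mul_one, mul_zero] at h
  refine h.congr' ?_
  obtain ⟨N, hN⟩ := NotPole.exists_add_natCast a
  filter_upwards [Filter.eventually_ne_atTop 0, Filter.eventually_ge_atTop N] with k hk hNk
  have hk' : (k : ℂ) ≠ 0 := Nat.cast_ne_zero.2 hk
  obtain ⟨i, rfl⟩ := Nat.exists_eq_add_of_le hNk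
  have h0 : a + (N + i : ℕ) ≠ 0 := by
    push_cast; rw [← add_assoc]; exact hN.add_natCast_ne_zero i
  set k := N + i
  have hf := cast_factorial_ne_zero k
  have ha : (k : ℂ) ^ a ≠ 0 := by simp [cpow_eq_zero_iff, hk']
  have hb : (k : ℂ) ^ b ≠ 0 := by simp [cpow_eq_zero_iff, hk']
  rw [gaussCoef, poch_succ, show b - 1 + (k : ℂ) + 1 = b + k by ring,
    show a + b - 1 + (j : ℂ) - 1 + k + 1 = a + b - 1 + j + k by ring,
    cpow_sub _ _ hk', cpow_sub _ _ hk', cpow_add _ _ hk', cpow_sub _ _ hk', cpow_add _ _ hk',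
    cpow_one, cpow_natCast, mul_inv, inv_inv, zero_add, inv_pow]
  field_simp

/-- A contiguous relation that telescopes: the combination of summands on the left is the increment
of the right side. -/
theorem sum_range_gaussCoef_succ (a c : ℂ) {b : ℂ} (hb : NotPole b) (N : ℕ) :
    (c - a - 1) * ∑ k ∈ Finset.range (N + 1), gaussCoef a b c k
      - (c - a - b - 1) * ∑ k ∈ Finset.range (N + 1), gaussCoef (a + 1) b c k
      = gaussCoef (a + 1) (b + 1) c N := by
  induction N with
  | zero =>
    simp [gaussCoef, poch_zero, Gamma_add_one _ hb.ne_zero]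
    ring
  | succ N ih =>
    rw [Finset.sum_range_succ, Finset.sum_range_succ _ (N + 1)]
    have h1 : (N : ℂ) + 1 ≠ 0 := Nat.cast_add_one_ne_zero N
    have h2 := cast_factorial_ne_zero N
    have e : (c - a - 1) * gaussCoef a b c (N + 1) - (c - a - b - 1) * gaussCoef (a + 1) b c (N + 1)
        = gaussCoef (a + 1) (b + 1) c (N + 1) - gaussCoef (a + 1) (b + 1) c N := by
      have hg : Gamma (b + 1 + (N + 1)) = (b + 1 + N) * Gamma (b + 1 + N) := by
        rw [← add_assoc, Gamma_add_one _ (hb.add_one.add_natCast_ne_zero N)]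
      rw [gaussCoef, gaussCoef, gaussCoef, gaussCoef, poch_succ_left a, poch_succ (a + 1),
        inv_Gamma_eq (c + N), Nat.factorial_succ]
      push_cast
      rw [hg, ← add_assoc c, show b + ((N : ℂ) + 1) = b + 1 + N by ring]
      field_simp
      ring
    linear_combination ih + e

/-- Gauss's summation theorem for `c = a + b + m + 1`. -/
theorem tendsto_sum_gaussCoef (m : ℕ) (a : ℂ) {b : ℂ} (hb : NotPole b) :
    Filter.Tendsto (fun N => ∑ k ∈ Finset.range N, gaussCoef a b (a + b + m + 1) k) Filter.atTop
      (𝓝 (Gamma b * m.factorial * (Gamma (a + m + 1))⁻¹ * (Gamma (b + m + 1))⁻¹)) := by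
  rw [← Filter.tendsto_add_atTop_iff_nat 1]
  induction m generalizing a with
  | zero =>
    -- Here `c - a - b - 1 = 0`, so the telescoped identity alone evaluates the partial sums.
    have h := (tendsto_gaussCoef (a + 1) (b + 1) 0).const_mul b⁻¹
    have hb0 := hb.ne_zero
    simp only [↓reduceIte, Nat.cast_zero, add_zero] at h
    convert h using 2 with N
    · have := sum_range_gaussCoef_succ a (a + b + 1) hb N
      rw [Nat.cast_zero, add_zero, show a + 1 + (b + 1) - 1 = a + b + 1 by ring, ← this]
      field_simp
      ring
    · rw [Nat.cast_zero, add_zero, add_zero, Gamma_add_one _ hb0]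
      have := hb.Gamma_ne_zero
      simp only [Nat.factorial_zero, Nat.cast_one]
      field_simp
  | succ m ih =>
    have hbm : b + m + 1 ≠ 0 := (hb.add_natCast m).add_one.ne_zero
    -- The telescoped identity now has coefficients `b + m + 1` and `m + 1`; its second sum is the
    -- previous case at `a + 1`, and its boundary term tends to `0`.
    have h := (((ih (a + 1)).const_mul ((m : ℂ) + 1)).add
      (tendsto_gaussCoef (a + 1) (b + 1) (m + 1))).const_mul (b + m + 1)⁻¹
    rw [if_neg (Nat.succ_ne_zero m), add_zero] at h
    convert h using 2 with N
    · have := sum_range_gaussCoef_succ a (a + b + (m + 1 : ℕ) + 1) hb N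
      push_cast at this ⊢
      rw [show a + 1 + (b + 1) - 1 + ((m : ℂ) + 1) = a + b + (m + 1) + 1 by ring,
        show a + 1 + b + (m : ℂ) + 1 = a + b + (m + 1) + 1 by ring, ← this]
      field_simp
      ring
    · rw [inv_Gamma_eq (b + m + 1), Nat.factorial_succ]
      push_cast
      rw [show a + 1 + (m : ℂ) + 1 = a + (m + 1) + 1 by ring,
        show b + (m : ℂ) + 1 + 1 = b + (m + 1) + 1 by ring]
      field_simp

/-! ### Euler's integral and Gauss's integral for the digamma function. -/

theorem hasSum_binomial (b : ℂ) {y : ℂ} (hy : ‖y‖ < 1) :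
    HasSum (fun k => poch b k / k.factorial * y ^ k) ((1 - y) ^ (-b)) := by
  have h := (one_div_one_sub_cpow_hasFPowerSeriesOnBall_zero b).hasSum (y := y)
    (by rw [← ENNReal.ofReal_one, Metric.eball_ofReal]; simpa using hy)
  simp only [FormalMultilinearSeries.ofScalars_apply_eq, zero_add, smul_eq_mul] at h
  rw [cpow_neg, ← one_div]
  refine h.congr_fun fun k => ?_
  congr 1
  rw [← Ring.multichoose_eq, div_eq_iff (cast_factorial_ne_zero k), mul_comm, ← nsmul_eq_mul,
    Ring.factorial_nsmul_multichoose_eq_ascPochhammer, Polynomial.ascPochhammer_smeval_eq_eval,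
    poch]

theorem norm_ofReal_cpow_sub_one_le {t : ℝ} (h0 : 0 ≤ t) (h1 : t ≤ 1) {s : ℂ} (hs : 1 ≤ s.re) :
    ‖(t : ℂ) ^ (s - 1)‖ ≤ 1 := by
  rcases h0.eq_or_lt with rfl | h0
  · by_cases h : s - 1 = 0 <;> simp [h]
  · rw [norm_cpow_eq_rpow_re_of_pos h0]
    exact Real.rpow_le_one h0.le h1 (by simpa using hs)

theorem Gamma_mul_gaussCoef {a : ℂ} (ha : NotPole a) (b c : ℂ) (k : ℕ) :
    Gamma a * gaussCoef a b c k
      = Gamma (a + k) * Gamma (b + k) * (Gamma (c + k))⁻¹ / k.factorial := by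
  rw [ha.Gamma_add_natCast, gaussCoef]
  ring

theorem Gamma_mul_gaussCoef_comm {a b : ℂ} (ha : NotPole a) (hb : NotPole b) (c : ℂ) (k : ℕ) :
    Gamma a * gaussCoef a b c k = Gamma b * gaussCoef b a c k := by
  rw [Gamma_mul_gaussCoef ha, Gamma_mul_gaussCoef hb]
  ring

/-- Euler's integral for `₂F₁(a, b; a + b; x)`. -/
theorem hasSum_integral_gaussCoef {a b : ℂ} (ha : 1 ≤ a.re) (hb : 1 ≤ b.re) {x : ℝ} (h0 : 0 ≤ x)
    (h1 : x < 1) :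
    HasSum (fun k => Gamma a * gaussCoef a b (a + b) k * (x : ℂ) ^ k)
      (∫ t in (0 : ℝ)..1, (t : ℂ) ^ (a - 1) * (1 - (t : ℂ)) ^ (b - 1)
        * (1 - (x : ℂ) * t) ^ (-b)) := by
  have hnx : ‖(x : ℂ)‖ < 1 := by rwa [Complex.norm_of_nonneg h0]
  have hbp : NotPole b := NotPole.of_re_pos (by linarith)
  have hap : NotPole a := NotPole.of_re_pos (by linarith)
  have hs : SubExp fun k => poch b k / k.factorial := by
    refine SubExp.of_ratio (SubExp.tendsto_add_div_add b 1) (Filter.Eventually.of_forall fun k => ?_)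
    have : (k : ℂ) + 1 ≠ 0 := Nat.cast_add_one_ne_zero k
    have := cast_factorial_ne_zero k
    rw [poch_succ, Nat.factorial_succ]
    push_cast
    rw [add_comm 1 (k : ℂ)]
    field_simp
  -- Expanding `(1 - x t) ^ (-b)` gives Beta integrals term by term. Since both real parts are at
  -- least `1`, the other factors have norm at most `1`, and the binomial series at `x` dominates.
  have h := intervalIntegral.hasSum_integral_of_dominated_convergence (a := 0) (b := 1)
    (μ := MeasureTheory.volume)
    (F := fun (k : ℕ) (t : ℝ) => poch b k / k.factorial * (x : ℂ) ^ k
      * ((t : ℂ) ^ (a + k - 1) * (1 - (t : ℂ)) ^ (b - 1)))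
    (f := fun t : ℝ => (t : ℂ) ^ (a - 1) * (1 - (t : ℂ)) ^ (b - 1) * (1 - (x : ℂ) * t) ^ (-b))
    (fun k _ => ‖poch b k / k.factorial * (x : ℂ) ^ k‖) ?_ ?_ ?_ ?_ ?_
  · refine h.congr_fun fun k => ?_
    rw [intervalIntegral.integral_const_mul]
    have e := betaIntegral_eq_Gamma_mul_div (a + k) b (by simp only [add_re, natCast_re]; positivity)
      (by linarith)
    rw [betaIntegral] at e
    rw [e, Gamma_mul_gaussCoef hap, hbp.Gamma_add_natCast, add_right_comm]
    ring
  · intro k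
    refine Measurable.aestronglyMeasurable ?_
    fun_prop
  · intro k
    refine Filter.Eventually.of_forall fun t ht => ?_
    rw [Set.uIoc_of_le zero_le_one] at ht
    rw [norm_mul, norm_mul (_ ^ _)]
    refine mul_le_of_le_one_right (norm_nonneg _) (mul_le_one₀ ?_ (norm_nonneg _) ?_)
    · exact norm_ofReal_cpow_sub_one_le ht.1.le ht.2
        (by simp only [add_re, natCast_re]; linarith [k.cast_nonneg (α := ℝ)])
    · rw [← ofReal_one, ← ofReal_sub, ofReal_one]
      exact norm_ofReal_cpow_sub_one_le (by linarith [ht.2]) (by linarith [ht.1]) hb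
  · exact Filter.Eventually.of_forall fun t _ => hs.summable_norm hnx
  · exact intervalIntegrable_const
  · refine Filter.Eventually.of_forall fun t ht => ?_
    rw [Set.uIoc_of_le zero_le_one] at ht
    have ht0 : (t : ℂ) ≠ 0 := ofReal_ne_zero.2 ht.1.ne'
    have hxt : ‖(x : ℂ) * t‖ < 1 := by
      rw [norm_mul, Complex.norm_of_nonneg h0, Complex.norm_of_nonneg ht.1.le]
      nlinarith [ht.1, ht.2]
    refine ((hasSum_binomial b hxt).mul_left
      ((t : ℂ) ^ (a - 1) * (1 - (t : ℂ)) ^ (b - 1))).congr_fun fun k => ?_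
    rw [show a + k - 1 = a - 1 + k by ring, cpow_add _ _ ht0, cpow_natCast, mul_pow]
    ring

/-- Mean value inequality; `Re a ≥ 2` bounds the derivative `(a - 1) t ^ (a - 2)`. The factor `1 -
t` is what cancels the singularity of `1 / (1 - t)` in the integrals below. -/
theorem norm_cpow_sub_one_sub_one_le {a : ℂ} (ha : 2 ≤ a.re) {t : ℝ} (h0 : 0 < t) (h1 : t ≤ 1) :
    ‖(t : ℂ) ^ (a - 1) - 1‖ ≤ ‖a - 1‖ * (1 - t) := by
  have ha1 : a - 1 ≠ 0 := fun h => by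
    have := congrArg re h
    simp only [sub_re, one_re, zero_re] at this
    linarith
  have h := (convex_Ioc (0 : ℝ) 1).norm_image_sub_le_of_norm_hasDerivWithin_le
    (f := fun y : ℝ => (y : ℂ) ^ (a - 1)) (C := ‖a - 1‖) (x := 1) (y := t)
    (fun x hx => (hasDerivAt_ofReal_cpow_const hx.1.ne' ha1).hasDerivWithinAt)
    (fun x hx => by
      rw [norm_mul]
      exact mul_le_of_le_one_right (norm_nonneg _)
        (norm_ofReal_cpow_sub_one_le hx.1.le hx.2 (by simp only [sub_re, one_re]; linarith)))
    ⟨one_pos, le_rfl⟩ ⟨h0, h1⟩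
  rwa [ofReal_one, one_cpow, Real.norm_eq_abs, abs_sub_comm, abs_of_nonneg (by linarith)] at h

theorem ae_ne_one : ∀ᵐ t : ℝ, t ≠ 1 := by
  simp [MeasureTheory.ae_iff]

/-- Gauss's integral for the digamma function. -/
theorem integral_eq_digamma_sub {a : ℂ} (ha : 2 ≤ a.re) :
    ∫ t in (0 : ℝ)..1, ((t : ℂ) ^ (a - 1) - 1) * (1 - (t : ℂ))⁻¹ = digamma 1 - digamma a := by
  have hap : NotPole a := NotPole.of_re_pos (by linarith)
  -- Replacing `1 / (1 - t)` by `(1 - t) ^ (ε - 1)` makes the two halves of the integrand separately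
  -- integrable, as Beta integrals.
  have l1 : Filter.Tendsto
      (fun ε : ℝ => ∫ t in (0 : ℝ)..1, ((t : ℂ) ^ (a - 1) - 1) * (1 - (t : ℂ)) ^ ((ε : ℂ) - 1))
      (𝓝[>] 0) (𝓝 (∫ t in (0 : ℝ)..1, ((t : ℂ) ^ (a - 1) - 1) * (1 - (t : ℂ))⁻¹)) := by
    refine intervalIntegral.tendsto_integral_filter_of_dominated_convergence
      (fun _ => ‖a - 1‖) ?_ ?_ intervalIntegrable_const ?_
    · refine Filter.Eventually.of_forall fun ε => Measurable.aestronglyMeasurable ?_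
      fun_prop
    · filter_upwards [self_mem_nhdsWithin] with ε hε
      filter_upwards [ae_ne_one] with t ht1 ht
      rw [Set.uIoc_of_le zero_le_one] at ht
      have h1t : 0 < 1 - t := by linarith [lt_of_le_of_ne ht.2 ht1]
      rw [norm_mul, ← ofReal_one, ← ofReal_sub, norm_cpow_eq_rpow_re_of_pos h1t, ofReal_one]
      have := norm_cpow_sub_one_sub_one_le ha ht.1 ht.2
      calc _ ≤ ‖a - 1‖ * (1 - t) * (1 - t) ^ ((ε : ℂ) - 1).re := by gcongr
        _ = ‖a - 1‖ * (1 - t) ^ ε := by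
          simp only [sub_re, ofReal_re, one_re]
          rw [Real.rpow_sub_one h1t.ne']
          field_simp
        _ ≤ ‖a - 1‖ := mul_le_of_le_one_right (norm_nonneg _)
          (Real.rpow_le_one h1t.le (by linarith [ht.1]) (le_of_lt hε))
    · filter_upwards [ae_ne_one] with t ht1 ht
      have h1t : (1 - t : ℂ) ≠ 0 := by
        rw [← ofReal_one, ← ofReal_sub]; exact ofReal_ne_zero.2 (sub_ne_zero.2 ht1.symm)
      have : Filter.Tendsto (fun ε : ℝ => (1 - (t : ℂ)) ^ ((ε : ℂ) - 1)) (𝓝 0)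
          (𝓝 ((1 - (t : ℂ)) ^ (((0 : ℝ) : ℂ) - 1))) :=
        Filter.Tendsto.const_cpow ((continuous_ofReal.tendsto 0).sub_const 1) (Or.inl h1t)
      rw [ofReal_zero, zero_sub, cpow_neg_one] at this
      exact (this.mono_left nhdsWithin_le_nhds).const_mul _
  -- The regularised integral `B(a, ε) - B(1, ε)` is exactly the difference quotient of this
  -- function at `0`.
  have hq : HasDerivAt (fun ε : ℂ => Gamma a * Gamma (1 + ε) / Gamma (a + ε))
      (digamma 1 - digamma a) 0 := by
    have d1 : HasDerivAt (fun ε : ℂ => Gamma (1 + ε)) (deriv Gamma 1) 0 := by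
      have : HasDerivAt Gamma (deriv Gamma 1) (1 + 0) := by
        rw [add_zero]; exact (differentiableAt_Gamma 1 NotPole.one).hasDerivAt
      simpa using this.comp_const_add 1 0
    have d2 : HasDerivAt (fun ε : ℂ => Gamma (a + ε)) (deriv Gamma a) 0 := by
      have : HasDerivAt Gamma (deriv Gamma a) (a + 0) := by
        rw [add_zero]; exact (differentiableAt_Gamma a hap).hasDerivAt
      simpa using this.comp_const_add a 0
    have hne := hap.Gamma_ne_zero
    refine ((d1.const_mul (Gamma a)).div d2 (by simpa using hne)).congr_deriv ?_
    simp only [digamma_def, logDeriv_apply, add_zero, Gamma_one]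
    field_simp
  have l2 : Filter.Tendsto
      (fun ε : ℝ => ∫ t in (0 : ℝ)..1, ((t : ℂ) ^ (a - 1) - 1) * (1 - (t : ℂ)) ^ ((ε : ℂ) - 1))
      (𝓝[>] 0) (𝓝 (digamma 1 - digamma a)) := by
    have hr : Filter.Tendsto (fun ε : ℝ => (ε : ℂ)) (𝓝[>] 0) (𝓝[≠] 0) := by
      refine tendsto_nhdsWithin_iff.2 ⟨?_, ?_⟩
      · have := (continuous_ofReal.tendsto 0).mono_left (nhdsWithin_le_nhds (s := Set.Ioi 0))
        rwa [ofReal_zero] at this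
      · filter_upwards [self_mem_nhdsWithin] with ε hε
        exact ofReal_ne_zero.2 (ne_of_gt hε)
    refine ((hasDerivAt_iff_tendsto_slope_zero.1 hq).comp hr).congr' ?_
    filter_upwards [self_mem_nhdsWithin] with ε hε
    have hε0 : (ε : ℂ) ≠ 0 := ofReal_ne_zero.2 (ne_of_gt hε)
    have hεr : 0 < (ε : ℂ).re := by simpa using hε
    have i1 := betaIntegral_convergent (u := a) (v := ε) (by linarith) hεr
    have i2 := betaIntegral_convergent (u := 1) (v := ε) (by simp) hεr
    have e1 := betaIntegral_eq_Gamma_mul_div a ε (by linarith) hεr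
    have e2 := betaIntegral_eq_Gamma_mul_div 1 ε (by simp) hεr
    have : ∀ t : ℝ, ((t : ℂ) ^ (a - 1) - 1) * (1 - (t : ℂ)) ^ ((ε : ℂ) - 1)
        = (t : ℂ) ^ (a - 1) * (1 - (t : ℂ)) ^ ((ε : ℂ) - 1)
          - (t : ℂ) ^ ((1 : ℂ) - 1) * (1 - (t : ℂ)) ^ ((ε : ℂ) - 1) := fun t => by
      rw [sub_self, cpow_zero]; ring
    simp only [this]
    rw [intervalIntegral.integral_sub i1 i2]
    rw [betaIntegral] at e1 e2
    rw [e1, e2]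
    have hne := hap.Gamma_ne_zero
    have g := Gamma_add_one (ε : ℂ) hε0
    rw [add_comm] at g
    have hg : Gamma (ε : ℂ) ≠ 0 := Gamma_ne_zero_of_re_pos hεr
    have hga : Gamma (a + ε) ≠ 0 :=
      Gamma_ne_zero_of_re_pos (by simp only [add_re]; linarith)
    simp only [Function.comp_apply, zero_add, smul_eq_mul, g, Gamma_one, add_zero]
    field_simp
  exact tendsto_nhds_unique l1 l2

/-- Since `1 - t ≤ 1 - x t` and `Re b > 0`, the last factor is dominated by its value at `x = 1`.
The powers of `1 - t` then combine to `1 / (1 - t)`, giving Gauss's integral in the limit. -/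
theorem tendsto_integral_digamma {a b : ℂ} (ha : 2 ≤ a.re) (hb : 1 ≤ b.re) :
    Filter.Tendsto (fun x : ℝ => ∫ t in (0 : ℝ)..1, ((t : ℂ) ^ (a - 1) - 1)
      * (1 - (t : ℂ)) ^ (b - 1) * (1 - (x : ℂ) * t) ^ (-b)) (𝓝[<] 1)
      (𝓝 (digamma 1 - digamma a)) := by
  rw [← integral_eq_digamma_sub ha]
  refine intervalIntegral.tendsto_integral_filter_of_dominated_convergence
      (fun _ => ‖a - 1‖) ?_ ?_ intervalIntegrable_const ?_
  · refine Filter.Eventually.of_forall fun x => Measurable.aestronglyMeasurable ?_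
    fun_prop
  · filter_upwards [self_mem_nhdsWithin] with x hx
    filter_upwards [ae_ne_one] with t ht1 ht
    rw [Set.uIoc_of_le zero_le_one] at ht
    have h1t : 0 < 1 - t := by linarith [lt_of_le_of_ne ht.2 ht1]
    have hxt : 1 - t ≤ 1 - x * t := by nlinarith [ht.1, (show x < 1 from hx)]
    have hxt0 : 0 < 1 - x * t := h1t.trans_le hxt
    rw [norm_mul, norm_mul, ← ofReal_mul, ← ofReal_one, ← ofReal_sub, ← ofReal_sub,
      norm_cpow_eq_rpow_re_of_pos h1t, norm_cpow_eq_rpow_re_of_pos hxt0, ofReal_one]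
    have h1 := norm_cpow_sub_one_sub_one_le ha ht.1 ht.2
    have h2 : (1 - x * t) ^ (-b).re ≤ (1 - t) ^ (-b).re :=
      Real.rpow_le_rpow_of_nonpos h1t hxt (by simp only [neg_re]; linarith)
    calc _ ≤ ‖a - 1‖ * (1 - t) * (1 - t) ^ (b - 1).re * (1 - t) ^ (-b).re := by gcongr
      _ = ‖a - 1‖ := by
        simp only [sub_re, one_re, neg_re]
        rw [Real.rpow_sub_one h1t.ne', Real.rpow_neg h1t.le]
        have := (Real.rpow_pos_of_pos h1t b.re).ne'
        field_simp
  · filter_upwards [ae_ne_one] with t ht1 ht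
    rw [Set.uIoc_of_le zero_le_one] at ht
    have h1t : 0 < 1 - t := by linarith [lt_of_le_of_ne ht.2 ht1]
    have h1t' : (1 - t : ℂ) ≠ 0 := by
      rw [← ofReal_one, ← ofReal_sub]; exact ofReal_ne_zero.2 h1t.ne'
    have hsl : (1 - ((1 : ℝ) : ℂ) * t) ∈ slitPlane := by
      rw [ofReal_one, one_mul, ← ofReal_one, ← ofReal_sub]
      exact ofReal_mem_slitPlane.2 h1t
    have hc : ContinuousAt (fun x : ℝ => (1 - (x : ℂ) * t) ^ (-b)) 1 :=
      ContinuousAt.cpow (by fun_prop) continuousAt_const hsl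
    have h := (hc.tendsto.mono_left (nhdsWithin_le_nhds (s := Set.Iio 1))).const_mul
      (((t : ℂ) ^ (a - 1) - 1) * (1 - (t : ℂ)) ^ (b - 1))
    convert h using 2
    rw [ofReal_one, one_mul, mul_assoc, ← cpow_add _ _ h1t']
    rw [show b - 1 + -b = -1 by ring, cpow_neg_one]

/-! ### The logarithmic singularity of `₂F₁(a, b; a + b; x)` at `1`. -/

theorem tendsto_mul_log : Filter.Tendsto (fun x : ℝ => (1 - (x : ℂ)) * log (1 - (x : ℂ)))
    (𝓝[<] 1) (𝓝 0) := by
  have h : Filter.Tendsto (fun x : ℝ => (((1 - x) * Real.log (1 - x) : ℝ) : ℂ)) (𝓝[<] 1)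
      (𝓝 (((1 - 1) * Real.log (1 - 1) : ℝ) : ℂ)) := by
    refine Filter.Tendsto.mono_left ?_ nhdsWithin_le_nhds
    exact (continuous_ofReal.comp
      (Real.continuous_mul_log.comp (continuous_const.sub continuous_id))).tendsto 1
  rw [sub_self, zero_mul, ofReal_zero] at h
  refine h.congr' ?_
  filter_upwards [self_mem_nhdsWithin] with x hx
  rw [ofReal_mul, ofReal_log (by linarith [show x < 1 from hx]), ofReal_sub, ofReal_one]

/-- Abel's limit theorem. -/
theorem tendsto_ps_of_tendsto_sum {c : ℕ → ℂ} {l : ℂ}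
    (h : Filter.Tendsto (fun N => ∑ k ∈ Finset.range N, c k) Filter.atTop (𝓝 l)) :
    Filter.Tendsto (fun x : ℝ => ps c x) (𝓝[<] 1) (𝓝 l) :=
  Filter.tendsto_map'_iff.1 (tendsto_tsum_powerSeries_nhdsWithin_lt h)

theorem eventually_norm_ofReal_lt_one : ∀ᶠ x : ℝ in 𝓝[<] 1, 0 < x ∧ x < 1 ∧ ‖(x : ℂ)‖ < 1 := by
  filter_upwards [self_mem_nhdsWithin, mem_nhdsWithin_of_mem_nhds (lt_mem_nhds zero_lt_one)]
    with x h1 h0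
  exact ⟨h0, h1, by rwa [Complex.norm_of_nonneg (le_of_lt h0)]⟩

/-- The logarithmic asymptotics of `₂F₁(a, b; a + b; x)` as `x` tends to `1`. -/
def LogAsymptotic (a b : ℂ) : Prop :=
  Filter.Tendsto (fun x : ℝ => Gamma a * ps (gaussCoef a b (a + b)) x + log (1 - (x : ℂ)))
    (𝓝[<] 1) (𝓝 (2 * digamma 1 - digamma a - digamma b))

namespace LogAsymptotic

theorem symm {a b : ℂ} (ha : NotPole a) (hb : NotPole b) (h : LogAsymptotic a b) :
    LogAsymptotic b a := by
  have e : ∀ x : ℝ, Gamma b * ps (gaussCoef b a (b + a)) x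
      = Gamma a * ps (gaussCoef a b (a + b)) x := fun x => by
    rw [← ps_const_mul, ← ps_const_mul]
    simp only [Gamma_mul_gaussCoef_comm ha hb, add_comm b a]
  simp only [LogAsymptotic, e]
  rwa [sub_right_comm]

/-- Here the function is `-log (1 - x) / x`, so adding the logarithm leaves `-(1 - x) log (1 - x) /
x`. -/
theorem one_one : LogAsymptotic 1 1 := by
  have e : (2 * digamma 1 - digamma 1 - digamma 1 : ℂ) = -0 * 1⁻¹ := by ring
  have hx : Filter.Tendsto (fun x : ℝ => (x : ℂ)⁻¹) (𝓝[<] 1) (𝓝 1⁻¹) := by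
    have := ((continuous_ofReal.tendsto 1).mono_left (nhdsWithin_le_nhds (s := Set.Iio 1)))
    rw [ofReal_one] at this
    exact this.inv₀ one_ne_zero
  rw [LogAsymptotic, e]
  refine (tendsto_mul_log.neg.mul hx).congr' ?_
  filter_upwards [eventually_norm_ofReal_lt_one] with x ⟨hx0, _, hx1⟩
  have hxc : (x : ℂ) ≠ 0 := ofReal_ne_zero.2 hx0.ne'
  have hs : HasSum (fun k : ℕ => (x : ℂ) * (gaussCoef 1 1 (1 + 1) k * (x : ℂ) ^ k))
      (-log (1 - (x : ℂ))) := by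
    have h := (hasSum_nat_add_iff' 1).2 (hasSum_taylorSeries_neg_log hx1)
    simp only [Finset.range_one, Finset.sum_singleton, pow_zero, CharP.cast_eq_zero, div_zero,
      sub_zero] at h
    refine h.congr_fun fun k => ?_
    have h1 : (k : ℂ) + 1 ≠ 0 := Nat.cast_add_one_ne_zero k
    have hf := cast_factorial_ne_zero k
    have g1 : Gamma (1 + k) = k.factorial := by rw [add_comm]; exact Gamma_nat_eq_factorial k
    have g2 : Gamma (1 + 1 + k) = (k + 1) * k.factorial := by
      rw [show (1 : ℂ) + 1 + k = k + 1 + 1 by ring, Gamma_add_one _ h1, Gamma_nat_eq_factorial]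
    rw [gaussCoef, poch_one, g1, g2, pow_succ]
    push_cast
    field_simp
  have hs' := ((subExp_gaussCoef 1 (1 + 1) NotPole.one).hasSum hx1).mul_left (x : ℂ)
  have e2 := hs'.unique hs
  rw [Gamma_one, one_mul]
  field_simp
  linear_combination -e2

/-- Euler's integrals for `a` and for `1` share the factors that depend on `b`; in their difference
the logarithm cancels and `tendsto_integral_digamma` applies. -/
theorem of_one {a b : ℂ} (ha : 2 ≤ a.re) (hb : 1 ≤ b.re) (h : LogAsymptotic 1 b) :
    LogAsymptotic a b := by
  have l := (tendsto_integral_digamma ha hb).add h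
  rw [show digamma 1 - digamma a + (2 * digamma 1 - digamma 1 - digamma b)
    = 2 * digamma 1 - digamma a - digamma b by ring] at l
  refine l.congr' ?_
  filter_upwards [eventually_norm_ofReal_lt_one] with x ⟨hx0, hx1, hx⟩
  have h1 := (hasSum_integral_gaussCoef (a := a) (by linarith) hb hx0.le hx1).tsum_eq
  have h2 := (hasSum_integral_gaussCoef (a := 1) (by simp) hb hx0.le hx1).tsum_eq
  have p : ∀ s : ℂ, ∑' k : ℕ, Gamma s * gaussCoef s b (s + b) k * (x : ℂ) ^ k
      = Gamma s * ps (gaussCoef s b (s + b)) x := fun s => ps_const_mul _ _ _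
  have hint : ∀ s : ℂ, 1 ≤ s.re → IntervalIntegrable (fun t : ℝ => (t : ℂ) ^ (s - 1)
      * (1 - (t : ℂ)) ^ (b - 1) * (1 - (x : ℂ) * t) ^ (-b)) MeasureTheory.volume 0 1 := by
    intro s hs
    refine (betaIntegral_convergent (by linarith) (by linarith)).mul_continuousOn ?_
    refine ContinuousOn.cpow (by fun_prop) continuousOn_const fun t ht => ?_
    rw [Set.uIcc_of_le zero_le_one] at ht
    rw [← ofReal_mul, ← ofReal_one, ← ofReal_sub]
    exact ofReal_mem_slitPlane.2 (by nlinarith [ht.1, ht.2])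
  rw [← p a, ← p 1, h1, h2, ← add_assoc]
  congr 1
  rw [← intervalIntegral.integral_add _ (hint 1 (by simp))]
  · congr 1
    ext t
    rw [sub_self, cpow_zero]
    ring
  · convert (hint a (by linarith)).sub (hint 1 (by simp)) using 1
    ext t
    rw [sub_self, cpow_zero]
    ring

/-- The functions at `a` and `a + 1` differ by a multiple of a series that Gauss's theorem sums at
`1`; the resulting `1 / a` is `ψ(a + 1) - ψ(a)`. -/
theorem of_add_one {a b : ℂ} (ha : NotPole a) (hb : NotPole b) (h : LogAsymptotic (a + 1) b) :
    LogAsymptotic a b := by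
  have l := h.add ((tendsto_ps_of_tendsto_sum (tendsto_sum_gaussCoef 0 a hb)).const_mul
    (b * Gamma a))
  have ha0 := ha.ne_zero
  have hb0 := hb.ne_zero
  have hga := ha.Gamma_ne_zero
  have hgb := hb.Gamma_ne_zero
  have e : 2 * digamma 1 - digamma (a + 1) - digamma b + b * Gamma a * (Gamma b
      * (Nat.factorial 0 : ℂ) * (Gamma (a + (0 : ℕ) + 1))⁻¹ * (Gamma (b + (0 : ℕ) + 1))⁻¹)
      = 2 * digamma 1 - digamma a - digamma b := by
    rw [digamma_apply_add_one a ha, Nat.cast_zero, add_zero, add_zero, Gamma_add_one _ ha0,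
      Gamma_add_one _ hb0, Nat.factorial_zero, Nat.cast_one]
    field_simp
    ring
  rw [e] at l
  refine l.congr' ?_
  filter_upwards [eventually_norm_ofReal_lt_one] with x ⟨hx0, hx1, hx⟩
  rw [add_right_comm, ← ps_const_mul, ← ps_const_mul, ← ps_const_mul, ← SubExp.ps_add _ _ hx]
  · congr 2
    ext k
    have h1 := Gamma_mul_gaussCoef ha.add_one b (a + 1 + b) k
    rw [h1, mul_assoc b, Gamma_mul_gaussCoef ha, Gamma_mul_gaussCoef ha, inv_Gamma_eq (a + b + k),
      add_right_comm a 1 (k : ℂ), Gamma_add_one _ (ha.add_natCast_ne_zero k), Nat.cast_zero,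
      add_zero, add_right_comm a 1 b, add_right_comm (a + b) 1]
    ring
  · exact (subExp_gaussCoef _ _ hb).const_mul _
  · exact (subExp_gaussCoef _ _ hb).const_mul _

theorem of_add_natCast {a b : ℂ} (ha : NotPole a) (hb : NotPole b) (k : ℕ)
    (h : LogAsymptotic (a + k) b) : LogAsymptotic a b := by
  induction k with
  | zero => simpa using h
  | succ k ih =>
    refine ih (of_add_one (ha.add_natCast k) hb ?_)
    rwa [Nat.cast_succ, ← add_assoc] at h

end LogAsymptotic

/-- Parameters of large real part are reached from `(1, 1)` by changing one at a time and using the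
symmetry; contiguity then lowers both. -/
theorem logAsymptotic {a b : ℂ} (ha : NotPole a) (hb : NotPole b) : LogAsymptotic a b := by
  have key : ∀ s : ℂ, ∃ k : ℕ, 2 ≤ (s + k).re := fun s => by
    obtain ⟨k, hk⟩ := exists_nat_ge (2 - s.re)
    exact ⟨k, by simp only [add_re, natCast_re]; linarith⟩
  have h1 : ∀ {s : ℂ}, 2 ≤ s.re → LogAsymptotic 1 s := fun hs =>
    (LogAsymptotic.of_one hs (by simp) LogAsymptotic.one_one).symm
      (NotPole.of_re_pos (by linarith)) NotPole.one
  obtain ⟨i, hi⟩ := key a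
  obtain ⟨j, hj⟩ := key b
  have hb' := hb.add_natCast j
  have h2 : LogAsymptotic (a + i) (b + j) := LogAsymptotic.of_one hi (by linarith) (h1 hj)
  exact ((LogAsymptotic.of_add_natCast ha hb' i h2).symm ha hb').of_add_natCast hb ha j |>.symm hb ha

/-! ### The hypergeometric operator and the logarithmic series. -/

theorem SubExp.hasSum_sq_mul_deriv {c : ℕ → ℂ} (hc : SubExp c) {z : ℂ} (hz : ‖z‖ < 1) :
    HasSum (fun k : ℕ => k * (k - 1) * c k * z ^ k) (z ^ 2 * ps (_root_.dcoef (_root_.dcoef c)) z) := by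
  rw [← hasSum_nat_add_iff' 1]
  simp only [Finset.range_one, Finset.sum_singleton, CharP.cast_eq_zero, zero_mul, sub_zero]
  rw [sq, mul_assoc]
  refine ((hc.dcoef.hasSum_mul_deriv hz).mul_left z).congr_fun fun k => ?_
  simp only [_root_.dcoef]
  push_cast
  ring

/-- The hypergeometric differential operator acting on a power series. -/
theorem SubExp.hypergeometric_ode {c d : ℕ → ℂ} (hc : SubExp c) {a b γ : ℂ}
    (h : ∀ k : ℕ, (k + 1) * (γ + k) * c (k + 1) - (a + k) * (b + k) * c k = d k)
    {z : ℂ} (hz : ‖z‖ < 1) :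
    z * (1 - z) * ps (_root_.dcoef (_root_.dcoef c)) z + (γ - (a + b + 1) * z) * ps (_root_.dcoef c) z
      - a * b * ps c z = ps d z := by
  have h1 := hc.dcoef.hasSum_mul_deriv hz
  have h2 := hc.hasSum_sq_mul_deriv hz
  have h3 := (hc.dcoef.hasSum hz).mul_left γ
  have h4 := (hc.hasSum_mul_deriv hz).mul_left (a + b + 1)
  have h5 := (hc.hasSum hz).mul_left (a * b)
  have h6 := (((h1.sub h2).add h3).sub h4).sub h5
  have h7 : HasSum (fun k => d k * z ^ k) _ := h6.congr_fun fun k => ?_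
  · rw [show ps d z = ∑' k, d k * z ^ k from rfl, h7.tsum_eq]
    ring
  · rw [← h k]
    simp only [_root_.dcoef]
    ring

theorem tendsto_inv_add_natCast (s : ℂ) :
    Filter.Tendsto (fun k : ℕ => (s + k)⁻¹) Filter.atTop (𝓝 0) := by
  have h := (tendsto_inv_atTop_nhds_zero_nat (𝕜 := ℂ)).mul (SubExp.tendsto_add_div_add 0 s)
  rw [zero_mul] at h
  refine h.congr' ?_
  filter_upwards [Filter.eventually_ne_atTop 0] with k hk
  have hk' : (k : ℂ) ≠ 0 := Nat.cast_ne_zero.2 hk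
  rw [zero_add, ← mul_div_assoc, inv_mul_cancel₀ hk', one_div]

/-- The increments `1 / (s + k)` are bounded. -/
theorem NotPole.subExp_digamma {s : ℂ} (hs : NotPole s) : SubExp fun k => digamma (s + k) := by
  obtain ⟨C, hC⟩ := (tendsto_inv_add_natCast s).norm.bddAbove_range
  refine SubExp.of_bounded_diff C fun k => ?_
  rw [Nat.cast_succ, ← add_assoc, digamma_apply_add_one _ (hs.add_natCast k), add_sub_cancel_left]
  exact hC ⟨k, rfl⟩

/-- The coefficients of the logarithm in the expansion about `1`. -/
noncomputable def logCoef (p q : ℂ) (m k : ℕ) : ℂ :=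
  poch p k * poch q k / (((k + m).factorial : ℂ) * (k.factorial : ℂ))

/-- The digamma factor in the expansion about `1`. -/
noncomputable def digammaCoef (p q : ℂ) (m k : ℕ) : ℂ :=
  digamma (p + k) + digamma (q + k) - digamma (m + 1 + k) - digamma (1 + k)

/-- The logarithmic part of the expansion about `1`. -/
noncomputable def logPart (p q : ℂ) (m : ℕ) (w : ℂ) : ℂ :=
  w ^ m * (log w * ps (logCoef p q m) w + ps (fun k => logCoef p q m k * digammaCoef p q m k) w)

theorem subExp_logCoef (p q : ℂ) (m : ℕ) : SubExp (logCoef p q m) := by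
  refine SubExp.of_ratio (ρ := fun k : ℕ => (p + k) / (m + 1 + k) * ((q + k) / (1 + k))) ?_
    (Filter.Eventually.of_forall fun k => ?_)
  · simpa using (SubExp.tendsto_add_div_add p (m + 1)).mul (SubExp.tendsto_add_div_add q 1)
  · have h1 : (m : ℂ) + 1 + k ≠ 0 := (NotPole.natCast_add_one m).add_natCast_ne_zero k
    have h2 : (1 : ℂ) + k ≠ 0 := NotPole.one.add_natCast_ne_zero k
    have h3 := cast_factorial_ne_zero k
    have h4 := cast_factorial_ne_zero (k + m)
    rw [logCoef, logCoef, poch_succ, poch_succ, Nat.factorial_succ, add_right_comm k 1,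
      Nat.factorial_succ]
    push_cast
    rw [show (k : ℂ) + m + 1 = m + 1 + k by ring, add_comm (k : ℂ) 1]
    field_simp

theorem subExp_logCoef_mul_digammaCoef {p q : ℂ} (hp : NotPole p) (hq : NotPole q) (m : ℕ) :
    SubExp fun k => logCoef p q m k * digammaCoef p q m k :=
  (subExp_logCoef p q m).mul (((hp.subExp_digamma.add hq.subExp_digamma).sub
    (NotPole.natCast_add_one m).subExp_digamma).sub NotPole.one.subExp_digamma)

theorem succ_mul_logCoef_succ (p q : ℂ) (k : ℕ) :
    (k + 1) * (1 + k) * logCoef p q 0 (k + 1) = (p + k) * (q + k) * logCoef p q 0 k := by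
  have h2 : (k : ℂ) + 1 ≠ 0 := Nat.cast_add_one_ne_zero k
  have h3 := cast_factorial_ne_zero k
  rw [logCoef, logCoef, poch_succ, poch_succ, add_zero, add_zero, Nat.factorial_succ,
    add_comm 1 (k : ℂ)]
  push_cast
  field_simp

theorem digammaCoef_succ {p q : ℂ} (hp : NotPole p) (hq : NotPole q) (k : ℕ) :
    digammaCoef p q 0 (k + 1)
      = digammaCoef p q 0 k + (p + k)⁻¹ + (q + k)⁻¹ - 2 * ((1 : ℂ) + k)⁻¹ := by
  simp only [digammaCoef, Nat.cast_succ, ← add_assoc, Nat.cast_zero, zero_add]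
  rw [digamma_apply_add_one _ (hp.add_natCast k), digamma_apply_add_one _ (hq.add_natCast k),
    digamma_apply_add_one _ (NotPole.one.add_natCast k)]
  ring

/-! ### Uniqueness on the lens and the connection formula for `c = a + b`. -/

/-- The intersection of the unit discs about `0` and `1`. -/
def lens : Set ℂ := Metric.ball 0 1 ∩ Metric.ball 1 1

theorem isOpen_lens : IsOpen lens := Metric.isOpen_ball.inter Metric.isOpen_ball

theorem convex_lens : Convex ℝ lens := (convex_ball _ _).inter (convex_ball _ _)

theorem mem_lens {w : ℂ} : w ∈ lens ↔ ‖w‖ < 1 ∧ ‖1 - w‖ < 1 := by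
  rw [lens, Set.mem_inter_iff, mem_ball_zero_iff, mem_ball_iff_norm']

theorem one_sub_mem_lens {w : ℂ} (hw : w ∈ lens) : 1 - w ∈ lens := by
  rw [mem_lens] at hw ⊢
  rw [sub_sub_cancel]
  exact hw.symm

theorem mem_slitPlane_of_mem_lens {w : ℂ} (hw : w ∈ lens) : w ∈ slitPlane := by
  have h := mem_slitPlane_of_norm_lt_one (z := w - 1) (by
    rw [norm_sub_rev]; exact (mem_lens.1 hw).2)
  rwa [add_sub_cancel] at h

theorem one_sub_ofReal_mem_lens {x : ℝ} (h0 : 0 < x) (h1 : x < 1) : 1 - (x : ℂ) ∈ lens := by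
  rw [mem_lens, sub_sub_cancel, ← ofReal_one, ← ofReal_sub, Complex.norm_of_nonneg (by linarith),
    Complex.norm_of_nonneg h0.le]
  constructor <;> linarith

/-- A solution of the hypergeometric equation on the lens which tends to zero at the corner `0`,
with subcritical derivative, vanishes. -/
theorem eq_zero_of_hypergeometric_ode {Y Y1 Y2 A A1 A2 : ℂ → ℂ} {s p : ℂ} {l : Filter ℂ} [l.NeBot]
    (hl : l ≤ 𝓝 0) (hlens : lens ∈ l)
    (hY : ∀ w ∈ lens, HasDerivAt Y (Y1 w) w) (hY1 : ∀ w ∈ lens, HasDerivAt Y1 (Y2 w) w)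
    (hA : ∀ w ∈ lens, HasDerivAt A (A1 w) w) (hA1 : ∀ w ∈ lens, HasDerivAt A1 (A2 w) w)
    (oY : ∀ w ∈ lens, w * (1 - w) * Y2 w + (1 - w - s * w) * Y1 w - p * Y w = 0)
    (oA : ∀ w ∈ lens, w * (1 - w) * A2 w + (1 - w - s * w) * A1 w - p * A w = 0)
    (tA : Filter.Tendsto A (𝓝 0) (𝓝 1)) {e : ℂ} (tA1 : Filter.Tendsto A1 (𝓝 0) (𝓝 e))
    (tY : Filter.Tendsto Y l (𝓝 0)) (tY1 : Filter.Tendsto (fun w => w * Y1 w) l (𝓝 0)) :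
    ∀ w ∈ lens, Y w = 0 := by
  have tid : Filter.Tendsto (fun w : ℂ => w) l (𝓝 0) := hl
  -- Abel's identity: `w (1 - w) ^ s` times the Wronskian is constant, and the behaviour along `l`
  -- forces the constant to be `0`.
  have hW : ∀ w ∈ lens, Y w * A1 w - A w * Y1 w = 0 := by
    intro w hw
    have hd : ∀ u ∈ lens, HasDerivAt
        (fun u => u * (1 - u) ^ s * (Y u * A1 u - A u * Y1 u)) 0 u := by
      intro u hu
      have hsl := mem_slitPlane_of_mem_lens (one_sub_mem_lens hu)
      have hne : 1 - u ≠ 0 := slitPlane_ne_zero hsl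
      have d0 : HasDerivAt (fun u : ℂ => (1 - u) ^ s) (s * (1 - u) ^ (s - 1) * -1) u :=
        ((hasDerivAt_id u).const_sub 1).cpow_const hsl
      refine (((hasDerivAt_id' u).mul d0).mul
        (((hY u hu).mul (hA1 u hu)).sub ((hA u hu).mul (hY1 u hu)))).congr_deriv ?_
      simp only [Pi.mul_apply, Pi.sub_apply]
      rw [cpow_sub _ _ hne, cpow_one]
      have o1 := oY u hu
      have o2 := oA u hu
      field_simp
      linear_combination (1 - u) ^ s * (Y u * o2 - A u * o1)
    have hconst : ∀ u ∈ lens, u * (1 - u) ^ s * (Y u * A1 u - A u * Y1 u)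
        = w * (1 - w) ^ s * (Y w * A1 w - A w * Y1 w) := fun u hu =>
      isOpen_lens.is_const_of_deriv_eq_zero convex_lens.isPreconnected
        (f := fun u => u * (1 - u) ^ s * (Y u * A1 u - A u * Y1 u))
        (fun v hv => (hd v hv).differentiableAt.differentiableWithinAt)
        (fun v hv => (hd v hv).deriv) hu hw
    have tc : Filter.Tendsto (fun u : ℂ => (1 - u) ^ s) l (𝓝 1) := by
      have h : ContinuousAt (fun u : ℂ => (1 - u) ^ s) 0 :=
        ContinuousAt.cpow (by fun_prop) continuousAt_const (by simp)
      have := h.tendsto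
      rw [sub_zero, one_cpow] at this
      exact this.mono_left hl
    have t : Filter.Tendsto (fun u => u * (1 - u) ^ s * (Y u * A1 u - A u * Y1 u)) l (𝓝 0) := by
      have := tc.mul (((tid.mul tY).mul (tA1.mono_left hl)).sub ((tA.mono_left hl).mul tY1))
      simp only [zero_mul, mul_zero, sub_self] at this
      refine this.congr fun u => ?_
      ring
    have h0 := tendsto_nhds_unique (tendsto_const_nhds.congr'
      (Filter.eventually_of_mem hlens fun u hu => (hconst u hu).symm)) t
    have hsl := mem_slitPlane_of_mem_lens (one_sub_mem_lens hw)
    have h1 : (1 - w) ^ s ≠ 0 := by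
      simp [cpow_eq_zero_iff, slitPlane_ne_zero hsl]
    have h2 : w ≠ 0 := slitPlane_ne_zero (mem_slitPlane_of_mem_lens hw)
    simpa [h1, h2] using h0
  -- With zero Wronskian, `Y / A` is constant wherever `A` has no zeros, which is guaranteed only
  -- near `0`; analyticity of `Y` covers the rest of the lens.
  obtain ⟨δ, hδ, hAδ⟩ := Metric.eventually_nhds_iff_ball.1 (tA.eventually_ne one_ne_zero)
  have hop : IsOpen (lens ∩ Metric.ball 0 δ) := isOpen_lens.inter Metric.isOpen_ball
  have hcx : Convex ℝ (lens ∩ Metric.ball 0 δ) := convex_lens.inter (convex_ball _ _)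
  have hmem : lens ∩ Metric.ball 0 δ ∈ l :=
    Filter.inter_mem hlens (hl (Metric.ball_mem_nhds 0 hδ))
  have hsmall : ∀ w ∈ lens ∩ Metric.ball 0 δ, Y w = 0 := by
    intro w hw
    have hd : ∀ u ∈ lens ∩ Metric.ball 0 δ, HasDerivAt (fun u => Y u / A u) 0 u := by
      intro u hu
      refine ((hY u hu.1).div (hA u hu.1) (hAδ u hu.2)).congr_deriv ?_
      rw [div_eq_zero_iff]
      left
      linear_combination -hW u hu.1
    have hconst : ∀ u ∈ lens ∩ Metric.ball 0 δ, Y u / A u = Y w / A w := fun u hu =>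
      hop.is_const_of_deriv_eq_zero hcx.isPreconnected (f := fun u => Y u / A u)
        (fun v hv => (hd v hv).differentiableAt.differentiableWithinAt)
        (fun v hv => (hd v hv).deriv) hu hw
    have t : Filter.Tendsto (fun u => Y u / A u) l (𝓝 (0 / 1)) :=
      tY.div (tA.mono_left hl) one_ne_zero
    have h0 := tendsto_nhds_unique (tendsto_const_nhds.congr'
      (Filter.eventually_of_mem hmem fun u hu => (hconst u hu).symm)) t
    rw [zero_div, div_eq_zero_iff] at h0
    exact h0.resolve_right (hAδ w hw.2)
  have hYa : AnalyticOnNhd ℂ Y lens := DifferentiableOn.analyticOnNhd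
    (fun w hw => (hY w hw).differentiableAt.differentiableWithinAt) isOpen_lens
  obtain ⟨w0, hw0⟩ := Filter.nonempty_of_mem hmem
  exact hYa.eqOn_zero_of_preconnected_of_eventuallyEq_zero convex_lens.isPreconnected hw0.1
    (Filter.eventually_of_mem (hop.mem_nhds hw0) hsmall)

theorem tendsto_one_sub_ofReal :
    Filter.Tendsto (fun x : ℝ => 1 - (x : ℂ)) (𝓝[<] 1) (𝓝 0) := by
  have h : Continuous fun x : ℝ => 1 - (x : ℂ) := by fun_prop
  have := (h.tendsto 1).mono_left (nhdsWithin_le_nhds (s := Set.Iio 1))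
  rwa [ofReal_one, sub_self] at this

theorem one_sub_mul_ps {c : ℕ → ℂ} (hc : SubExp c) {z : ℂ} (hz : ‖z‖ < 1) :
    (1 - z) * ps c z = c 0 + z * ps (fun k => c (k + 1) - c k) z := by
  rw [hc.shift.ps_sub hc hz, sub_mul, one_mul]
  nth_rw 1 [hc.ps_eq_add hz]
  ring

/-- If the coefficients converge, then `(1 - x) f(x)` has the same limit. -/
theorem tendsto_one_sub_mul_ps {c : ℕ → ℂ} (hc : SubExp c) {l : ℂ}
    (h : Filter.Tendsto c Filter.atTop (𝓝 l)) :
    Filter.Tendsto (fun x : ℝ => (1 - (x : ℂ)) * ps c x) (𝓝[<] 1) (𝓝 l) := by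
  have h1 : Filter.Tendsto (fun N => ∑ k ∈ Finset.range N, (c (k + 1) - c k)) Filter.atTop
      (𝓝 (l - c 0)) := by
    simp only [Finset.sum_range_sub]
    exact h.sub_const _
  have hx : Filter.Tendsto (fun x : ℝ => (x : ℂ)) (𝓝[<] 1) (𝓝 1) := by
    have := ((continuous_ofReal.tendsto 1).mono_left (nhdsWithin_le_nhds (s := Set.Iio 1)))
    rwa [ofReal_one] at this
  have h2 := (hx.mul (tendsto_ps_of_tendsto_sum h1)).const_add (c 0)
  rw [one_mul, add_sub_cancel] at h2
  refine h2.congr' ?_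
  filter_upwards [eventually_norm_ofReal_lt_one] with x ⟨_, _, hx⟩
  exact (one_sub_mul_ps hc hx).symm

theorem tendsto_mul_log_mul {f : ℂ → ℂ} {e : ℂ} (hf : Filter.Tendsto f (𝓝 0) (𝓝 e)) :
    Filter.Tendsto (fun x : ℝ => (1 - (x : ℂ)) * log (1 - (x : ℂ)) * f (1 - (x : ℂ))) (𝓝[<] 1)
      (𝓝 0) := by
  have := tendsto_mul_log.mul (hf.comp tendsto_one_sub_ofReal)
  rwa [zero_mul] at this

/-- The connection formula for `c = a + b`. -/
theorem connection_zero {a b : ℂ} (ha : NotPole a) (hb : NotPole b) :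
    ∀ w ∈ lens, Gamma a * ps (gaussCoef a b (a + b)) (1 - w) + logPart a b 0 w = 0 := by
  set g := gaussCoef a b (a + b) with hg
  set α := logCoef a b 0 with hα
  set η := fun k => logCoef a b 0 k * digammaCoef a b 0 k with hη
  have sg : SubExp g := subExp_gaussCoef a (a + b) hb
  have sα : SubExp α := subExp_logCoef a b 0
  have sη : SubExp η := subExp_logCoef_mul_digammaCoef ha hb 0
  have og := fun z (hz : ‖z‖ < 1) => sg.hypergeometric_ode (a := a) (b := b) (γ := a + b)
    (d := fun _ => 0) (fun k => sub_eq_zero.2 (gaussCoef_recurrence a (a + b) hb k)) hz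
  have oα := fun z (hz : ‖z‖ < 1) => sα.hypergeometric_ode (a := a) (b := b) (γ := 1)
    (d := fun _ => 0) (fun k => sub_eq_zero.2 (succ_mul_logCoef_succ a b k)) hz
  -- The operator applied to `log w · α(w)` leaves `2 (1 - w) α' - (a + b) α` besides the multiple
  -- of `log w`. The source term for `η` is its negative.
  have oη := fun z (hz : ‖z‖ < 1) => sη.hypergeometric_ode (a := a) (b := b) (γ := 1)
    (d := fun k => (a + b) * α k + 2 * (k * α k - dcoef α k)) (fun k => by
      have h1 := succ_mul_logCoef_succ a b k
      have h2 : (1 : ℂ) + k ≠ 0 := NotPole.one.add_natCast_ne_zero k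
      have h3 := ha.add_natCast_ne_zero k
      have h4 := hb.add_natCast_ne_zero k
      have h5 : logCoef a b 0 (k + 1) = (a + k) * (b + k) * logCoef a b 0 k / ((1 + k) * (1 + k)) := by
        rw [eq_div_iff (mul_ne_zero h2 h2)]
        linear_combination h1
      simp only [hη, hα, dcoef, digammaCoef_succ ha hb, h5, add_comm (k : ℂ) 1]
      field_simp
      ring) hz
  have z0 : ∀ z, ps (fun _ => 0) z = 0 := fun z => by simp [ps]
  have nb : ∀ w ∈ lens, ‖w‖ < 1 := fun w hw => (mem_lens.1 hw).1
  have nb' : ∀ w ∈ lens, ‖1 - w‖ < 1 := fun w hw => (mem_lens.1 hw).2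
  have dcomp : ∀ {c : ℕ → ℂ}, SubExp c → ∀ w ∈ lens,
      HasDerivAt (fun w => ps c (1 - w)) (-ps (dcoef c) (1 - w)) w := fun hc w hw => by
    have := (hc.hasDerivAt (nb' w hw)).comp w ((hasDerivAt_id w).const_sub 1)
    exact this.congr_deriv (by ring)
  have dlog : ∀ w ∈ lens, HasDerivAt log w⁻¹ w := fun w hw =>
    hasDerivAt_log (mem_slitPlane_of_mem_lens hw)
  have hl : Filter.map (fun x : ℝ => 1 - (x : ℂ)) (𝓝[<] 1) ≤ 𝓝 0 := tendsto_one_sub_ofReal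
  have α0 : α 0 = 1 := by simp [hα, logCoef, poch_zero]
  have tα := sα.tendsto_zero
  rw [α0] at tα
  have key := eq_zero_of_hypergeometric_ode
    (l := Filter.map (fun x : ℝ => 1 - (x : ℂ)) (𝓝[<] 1))
    (Y := fun w => Gamma a * ps g (1 - w) + (log w * ps α w + ps η w))
    (Y1 := fun w => -Gamma a * ps (dcoef g) (1 - w)
      + (w⁻¹ * ps α w + log w * ps (dcoef α) w + ps (dcoef η) w))
    (Y2 := fun w => Gamma a * ps (dcoef (dcoef g)) (1 - w)
      + (-(w ^ 2)⁻¹ * ps α w + w⁻¹ * ps (dcoef α) w + (w⁻¹ * ps (dcoef α) w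
        + log w * ps (dcoef (dcoef α)) w) + ps (dcoef (dcoef η)) w))
    (A := ps α) (A1 := ps (dcoef α)) (A2 := ps (dcoef (dcoef α))) (s := a + b) (p := a * b)
    (e := dcoef α 0) hl ?_ ?_ ?_ ?_ ?_ ?_ ?_ tα sα.dcoef.tendsto_zero ?_ ?_
  · intro w hw
    have := key w hw
    simpa only [logPart, pow_zero, one_mul] using this
  · rw [Filter.mem_map]
    filter_upwards [eventually_norm_ofReal_lt_one] with x ⟨h0, h1, _⟩
    exact one_sub_ofReal_mem_lens h0 h1
  · intro w hw
    exact (((dcomp sg w hw).const_mul (Gamma a)).add (((dlog w hw).mul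
      (sα.hasDerivAt (nb w hw))).add (sη.hasDerivAt (nb w hw)))).congr_deriv (by ring)
  · intro w hw
    have hw0 : w ≠ 0 := slitPlane_ne_zero (mem_slitPlane_of_mem_lens hw)
    exact (((dcomp sg.dcoef w hw).const_mul (-Gamma a)).add
      ((((hasDerivAt_inv hw0).mul (sα.hasDerivAt (nb w hw))).add ((dlog w hw).mul
      (sα.dcoef.hasDerivAt (nb w hw)))).add (sη.dcoef.hasDerivAt (nb w hw)))).congr_deriv (by ring)
  · exact fun w hw => sα.hasDerivAt (nb w hw)
  · exact fun w hw => sα.dcoef.hasDerivAt (nb w hw)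
  · intro w hw
    have hw0 : w ≠ 0 := slitPlane_ne_zero (mem_slitPlane_of_mem_lens hw)
    have e1 := og (1 - w) (nb' w hw)
    have e2 := oα w (nb w hw)
    have e3 := oη w (nb w hw)
    have e4 : ps (fun k => (a + b) * α k + 2 * (k * α k - dcoef α k)) w
        = (a + b) * ps α w + 2 * (w * ps (dcoef α) w - ps (dcoef α) w) := by
      have skα := SubExp.natCast.mul sα
      rw [(sα.const_mul _).ps_add ((skα.sub sα.dcoef).const_mul 2) (nb w hw), ps_const_mul,
        ps_const_mul, skα.ps_sub sα.dcoef (nb w hw)]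
      congr 4
      exact (sα.hasSum_mul_deriv (nb w hw)).tsum_eq
    rw [e4] at e3
    rw [z0] at e1 e2
    field_simp
    linear_combination w * Gamma a * e1 + w * log w * e2 + w * e3
  · intro w hw
    have e2 := oα w (nb w hw)
    rw [z0] at e2
    linear_combination e2
  · rw [Filter.tendsto_map'_iff]
    have t1 := logAsymptotic ha hb
    have t2 := (sη.tendsto_zero).comp tendsto_one_sub_ofReal
    have t3 := tendsto_mul_log_mul sα.shift.tendsto_zero
    have t := (t1.add t3).add t2
    -- The constant term of `η` is `ψ(a) + ψ(b) - 2 ψ(1)`, which cancels the constant of the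
    -- logarithmic asymptotics.
    have e : 2 * digamma 1 - digamma a - digamma b + 0 + η 0 = 0 := by
      simp [hη, logCoef, poch_zero, digammaCoef]
      ring
    rw [e] at t
    refine t.congr' ?_
    filter_upwards [eventually_norm_ofReal_lt_one] with x ⟨h0, h1, _⟩
    have := sα.ps_eq_add (nb _ (one_sub_ofReal_mem_lens h0 h1))
    rw [α0] at this
    simp only [Function.comp_apply, sub_sub_cancel, ← hg]
    rw [this]
    ring
  · rw [Filter.tendsto_map'_iff]
    -- Since the coefficients of `g'` tend to `1 / Γ(a)`, the term `-Γ(a) w g'(1 - w)` tends to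
    -- `-1`, against `+1` from the derivative of the logarithm.
    have tg : Filter.Tendsto (dcoef g) Filter.atTop (𝓝 (Gamma a)⁻¹) := by
      have h := (tendsto_gaussCoef (a + 1) (b + 1) 0).const_mul a
      rw [if_pos rfl, ← inv_Gamma_eq] at h
      rw [dcoef_gaussCoef]
      convert h using 4
      push_cast
      ring
    have t1 := (tendsto_one_sub_mul_ps sg.dcoef tg).const_mul (-Gamma a)
    have t2 := tα.comp tendsto_one_sub_ofReal
    have t3 := tendsto_mul_log_mul sα.dcoef.tendsto_zero
    have t4 := tendsto_one_sub_ofReal.mul (sη.dcoef.tendsto_zero.comp tendsto_one_sub_ofReal)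
    have t := ((t1.add t2).add t3).add t4
    have hga := ha.Gamma_ne_zero
    rw [neg_mul, mul_inv_cancel₀ hga, zero_mul, add_zero, add_zero, neg_add_cancel] at t
    refine t.congr' ?_
    filter_upwards [eventually_norm_ofReal_lt_one] with x ⟨h0, h1, _⟩
    have hw0 : 1 - (x : ℂ) ≠ 0 :=
      slitPlane_ne_zero (mem_slitPlane_of_mem_lens (one_sub_ofReal_mem_lens h0 h1))
    simp only [Function.comp_apply, sub_sub_cancel]
    field_simp
    ring

/-! ### The connection formula for `c = a + b + m`. -/

/-- The polynomial part of the expansion about `1`. -/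
noncomputable def finPart (a b : ℂ) (m : ℕ) (w : ℂ) : ℂ :=
  ∑ k ∈ Finset.range m, (-1) ^ k / (k.factorial : ℂ) * Gamma (b + k) * poch a k
    * ((m - 1 - k).factorial : ℂ) * w ^ k

/-- The expansion of `Γ(b) / Γ(a + b + m) * ₂F₁(a, b; a + b + m; z)` in powers of `w = 1 - z`. -/
noncomputable def connection (a b : ℂ) (m : ℕ) (w : ℂ) : ℂ :=
  (Gamma (a + m))⁻¹ * (Gamma (b + m))⁻¹ * finPart a b m w
    + (-1) ^ (m + 1) * (Gamma a)⁻¹ * logPart (a + m) (b + m) m w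

theorem hasDerivAt_finPart (a b : ℂ) (m : ℕ) (w : ℂ) :
    HasDerivAt (finPart a b (m + 1)) (-a * finPart (a + 1) (b + 1) m w) w := by
  have h : HasDerivAt (finPart a b (m + 1)) (∑ k ∈ Finset.range (m + 1),
      (-1) ^ k / (k.factorial : ℂ) * Gamma (b + k) * poch a k
        * ((m + 1 - 1 - k).factorial : ℂ) * (k * w ^ (k - 1))) w :=
    HasDerivAt.fun_sum fun k _ => (hasDerivAt_pow k w).const_mul _
  refine h.congr_deriv ?_
  rw [Finset.sum_range_succ', finPart, Finset.mul_sum]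
  simp only [CharP.cast_eq_zero, zero_mul, mul_zero, add_zero, Nat.add_sub_cancel]
  refine Finset.sum_congr rfl fun k _ => ?_
  have h1 : (k : ℂ) + 1 ≠ 0 := Nat.cast_add_one_ne_zero k
  have h2 := cast_factorial_ne_zero k
  rw [poch_succ_left, Nat.factorial_succ, show m - (k + 1) = m - 1 - k by omega]
  push_cast
  rw [add_assoc b 1, add_comm (1 : ℂ) k, pow_succ]
  field_simp

theorem hasDerivAt_logPart_product {p q : ℂ} (hp : NotPole p) (hq : NotPole q) (m : ℕ) {w : ℂ}
    (hw : ‖w‖ < 1) (hs : w ∈ slitPlane) :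
    HasDerivAt (logPart p q m) (m * w ^ (m - 1) * (log w * ps (logCoef p q m) w
      + ps (fun k => logCoef p q m k * digammaCoef p q m k) w)
      + w ^ m * (w⁻¹ * ps (logCoef p q m) w + log w * ps (dcoef (logCoef p q m)) w
      + ps (dcoef fun k => logCoef p q m k * digammaCoef p q m k) w)) w :=
  (hasDerivAt_pow m w).mul (((hasDerivAt_log hs).mul ((subExp_logCoef p q m).hasDerivAt hw)).add
    ((subExp_logCoef_mul_digammaCoef hp hq m).hasDerivAt hw))

theorem mul_logCoef_succ (p q : ℂ) (m k : ℕ) :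
    (m + 1 + k) * logCoef p q (m + 1) k = logCoef p q m k := by
  have h1 : (m : ℂ) + 1 + k ≠ 0 := (NotPole.natCast_add_one m).add_natCast_ne_zero k
  have h2 := cast_factorial_ne_zero k
  have h3 := cast_factorial_ne_zero (k + m)
  rw [logCoef, logCoef, ← add_assoc, Nat.factorial_succ]
  push_cast
  rw [show (k : ℂ) + m + 1 = m + 1 + k by ring]
  field_simp

theorem digammaCoef_eq_add (p q : ℂ) (m k : ℕ) :
    digammaCoef p q m k = digammaCoef p q (m + 1) k + ((m : ℂ) + 1 + k)⁻¹ := by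
  have h := digamma_apply_add_one _ ((NotPole.natCast_add_one m).add_natCast k)
  rw [digammaCoef, digammaCoef, Nat.cast_succ,
    show (m : ℂ) + 1 + 1 + k = m + 1 + k + 1 by ring, h]
  ring

/-- Differentiating `w ^ (k + m + 1) (log w + d)` adds `1 / (k + m + 1)` to `d`, exactly the step of
the digamma function in `digammaCoef_eq_add`. -/
theorem hasDerivAt_logPart {p q : ℂ} (hp : NotPole p) (hq : NotPole q) (m : ℕ) {w : ℂ}
    (hw : ‖w‖ < 1) (hs : w ∈ slitPlane) :
    HasDerivAt (logPart p q (m + 1)) (logPart p q m w) w := by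
  refine (hasDerivAt_logPart_product hp hq (m + 1) hw hs).congr_deriv ?_
  have hw0 := slitPlane_ne_zero hs
  have s1 := subExp_logCoef p q (m + 1)
  have s2 := subExp_logCoef_mul_digammaCoef hp hq (m + 1)
  have e1 : ps (logCoef p q m) w
      = (m + 1) * ps (logCoef p q (m + 1)) w + w * ps (dcoef (logCoef p q (m + 1))) w := by
    refine (((s1.hasSum hw).mul_left _).add (s1.hasSum_mul_deriv hw)).congr_fun (fun k => ?_)
      |>.tsum_eq
    rw [← mul_logCoef_succ]
    ring
  have e2 : ps (fun k => logCoef p q m k * digammaCoef p q m k) w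
      = (m + 1) * ps (fun k => logCoef p q (m + 1) k * digammaCoef p q (m + 1) k) w
        + w * ps (dcoef fun k => logCoef p q (m + 1) k * digammaCoef p q (m + 1) k) w
        + ps (logCoef p q (m + 1)) w := by
    refine ((((s2.hasSum hw).mul_left _).add (s2.hasSum_mul_deriv hw)).add
      (s1.hasSum hw)).congr_fun (fun k => ?_) |>.tsum_eq
    have h1 : (m : ℂ) + 1 + k ≠ 0 := (NotPole.natCast_add_one m).add_natCast_ne_zero k
    beta_reduce
    rw [digammaCoef_eq_add p q m k, ← mul_logCoef_succ p q m k]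
    field_simp
  rw [logPart, e1, e2, Nat.add_sub_cancel, Nat.cast_succ, pow_succ]
  field_simp
  ring

/-- The counterpart of `dcoef_gaussCoef` under `w = 1 - z`. The factor `a` comes out of `(a)_k` in
the finite part and out of `1 / Γ(a) = a / Γ(a + 1)` in the logarithmic part. -/
theorem hasDerivAt_connection {a b : ℂ} (m : ℕ) (ha : NotPole (a + (m + 1 : ℕ)))
    (hb : NotPole b) {w : ℂ} (hw : ‖w‖ < 1) (hs : w ∈ slitPlane) :
    HasDerivAt (connection a b (m + 1)) (-a * connection (a + 1) (b + 1) m w) w := by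
  refine (((hasDerivAt_finPart a b m w).const_mul _).add ((hasDerivAt_logPart ha
    (hb.add_natCast (m + 1)) m hw hs).const_mul _)).congr_deriv ?_
  rw [connection, inv_Gamma_eq a]
  push_cast
  rw [add_assoc a 1, add_assoc b 1, add_comm (1 : ℂ) m]
  ring

theorem differentiableOn_connection {a b : ℂ} (m : ℕ) (ha : NotPole (a + m)) (hb : NotPole b) :
    DifferentiableOn ℂ (connection a b m) (Metric.ball 0 1 ∩ slitPlane) := by
  intro w hw
  rcases m with _ | m
  · have h := hasDerivAt_logPart_product ha (hb.add_natCast 0) 0 (mem_ball_zero_iff.1 hw.1) hw.2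
    have h0 : DifferentiableAt ℂ (finPart a b 0) w := by
      have : finPart a b 0 = fun _ => 0 := by ext; simp [finPart]
      rw [this]
      exact differentiableAt_const _
    exact ((h0.const_mul _).add (h.differentiableAt.const_mul _)).differentiableWithinAt
  · exact (hasDerivAt_connection m ha hb (mem_ball_zero_iff.1 hw.1) hw.2
      ).differentiableAt.differentiableWithinAt

/-- Only the constant term of the finite part survives: the logarithmic part carries at least one
factor `w`, and `w log w` tends to `0`. -/
theorem tendsto_connection {a b : ℂ} (m : ℕ) (ha : NotPole (a + (m + 1 : ℕ))) (hb : NotPole b) :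
    Filter.Tendsto (fun x : ℝ => connection a b (m + 1) (1 - x)) (𝓝[<] 1)
      (𝓝 (Gamma b * m.factorial * (Gamma (a + m + 1))⁻¹ * (Gamma (b + m + 1))⁻¹)) := by
  have hb' := hb.add_natCast (m + 1)
  have t1 := ((hasDerivAt_finPart a b m 0).continuousAt.tendsto).comp tendsto_one_sub_ofReal
  have e1 : finPart a b (m + 1) 0 = Gamma b * m.factorial := by
    rw [finPart, Finset.sum_eq_single_of_mem 0 (by simp) (fun k _ hk => by simp [hk])]
    simp [poch_zero]
  have s1 := subExp_logCoef (a + (m + 1 : ℕ)) (b + (m + 1 : ℕ)) (m + 1)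
  have s2 := subExp_logCoef_mul_digammaCoef ha hb' (m + 1)
  have t2 := tendsto_mul_log_mul s1.tendsto_zero
  have t3 := tendsto_one_sub_ofReal.mul (s2.tendsto_zero.comp tendsto_one_sub_ofReal)
  have t4 : Filter.Tendsto (fun x : ℝ => logPart (a + (m + 1 : ℕ)) (b + (m + 1 : ℕ)) (m + 1)
      (1 - (x : ℂ))) (𝓝[<] 1) (𝓝 0) := by
    have := (tendsto_one_sub_ofReal.pow m).mul (t2.add t3)
    rw [zero_mul, add_zero, mul_zero] at this
    refine this.congr fun x => ?_
    rw [logPart, pow_succ, Function.comp_apply]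
    ring
  have t := (t1.const_mul ((Gamma (a + (m + 1 : ℕ)))⁻¹ * (Gamma (b + (m + 1 : ℕ)))⁻¹)).add
    (t4.const_mul ((-1) ^ (m + 1 + 1) * (Gamma a)⁻¹))
  rw [e1, mul_zero, add_zero] at t
  have e : Gamma b * m.factorial * (Gamma (a + m + 1))⁻¹ * (Gamma (b + m + 1))⁻¹
      = (Gamma (a + (m + 1 : ℕ)))⁻¹ * (Gamma (b + (m + 1 : ℕ)))⁻¹ * (Gamma b * m.factorial) := by
    push_cast
    rw [add_assoc a, add_assoc b]
    ring
  rwa [e]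

/-- Induction by integration from the corner `w = 0`. The sum `a + m` is the same for `(a, m + 1)`
and `(a + 1, m)`, so only it has to avoid the poles; `a` itself may be a nonpositive integer when `m
> 0`. -/
theorem connection_formula (m : ℕ) {a b : ℂ} (ha : NotPole (a + m)) (hb : NotPole b) :
    ∀ w ∈ lens, ps (gaussCoef a b (a + b + m)) (1 - w) = connection a b m w := by
  induction m generalizing a b with
  | zero =>
    intro w hw
    rw [Nat.cast_zero, add_zero] at ha
    have h := connection_zero ha hb w hw
    have hga := ha.Gamma_ne_zero
    simp only [connection, finPart, Finset.range_zero, Finset.sum_empty, mul_zero, zero_add,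
      Nat.cast_zero, add_zero, pow_one]
    field_simp
    linear_combination h
  | succ m ih =>
    intro w hw
    have ih' := ih (a := a + 1) (b := b + 1)
      (by convert ha using 1; push_cast; ring) hb.add_one
    have sg := subExp_gaussCoef a (a + b + (m + 1 : ℕ)) hb
    have hd : ∀ u ∈ lens, HasDerivAt (fun u => ps (gaussCoef a b (a + b + (m + 1 : ℕ))) (1 - u)
        - connection a b (m + 1) u) 0 u := by
      intro u hu
      have hu' := mem_lens.1 hu
      have d1 := (sg.hasDerivAt hu'.2).comp u ((hasDerivAt_id u).const_sub 1)
      refine (d1.sub (hasDerivAt_connection m ha hb hu'.1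
        (mem_slitPlane_of_mem_lens hu))).congr_deriv ?_
      rw [← ih' u hu, dcoef_gaussCoef, ps_const_mul,
        show a + b + (m + 1 : ℕ) + 1 = a + 1 + (b + 1) + m by push_cast; ring]
      ring
    have t := (tendsto_ps_of_tendsto_sum (tendsto_sum_gaussCoef m a hb)).sub
      (tendsto_connection m ha hb)
    rw [sub_self] at t
    refine sub_eq_zero.1 (tendsto_nhds_unique (tendsto_const_nhds.congr' ?_) t)
    filter_upwards [eventually_norm_ofReal_lt_one] with x ⟨h0, h1, _⟩
    have := isOpen_lens.is_const_of_deriv_eq_zero convex_lens.isPreconnected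
      (f := fun u => ps (gaussCoef a b (a + b + (m + 1 : ℕ))) (1 - u) - connection a b (m + 1) u)
      (fun v hv => (hd v hv).differentiableAt.differentiableWithinAt)
      (fun v hv => (hd v hv).deriv) hw (one_sub_ofReal_mem_lens h0 h1)
    simp only [sub_sub_cancel] at this
    rw [this, Nat.cast_succ, ← add_assoc]

/-! ### Analytic continuation beyond the unit disc. -/

/-- The part of the unit disc about `1` on which `log (1 - w)` is analytic. -/
def cutDisc : Set ℂ := Metric.ball 1 1 ∩ {w | 1 - w ∈ slitPlane}

/-- The union of the unit disc about `0` and the cut unit disc about `1`. -/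
def discUnion : Set ℂ := Metric.ball 0 1 ∪ cutDisc

theorem isOpen_cutDisc : IsOpen cutDisc :=
  Metric.isOpen_ball.inter (isOpen_slitPlane.preimage (by fun_prop))

theorem isOpen_discUnion : IsOpen discUnion := Metric.isOpen_ball.union isOpen_cutDisc

theorem mem_cutDisc {w : ℂ} : w ∈ cutDisc ↔ ‖1 - w‖ < 1 ∧ 1 - w ∈ slitPlane := by
  rw [cutDisc, Set.mem_inter_iff, mem_ball_iff_norm', Set.mem_ofPred_eq]

theorem one_sub_mem_of_mem_cutDisc {w : ℂ} (hw : w ∈ cutDisc) :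
    1 - w ∈ Metric.ball 0 1 ∩ slitPlane := by
  rw [mem_cutDisc] at hw
  exact ⟨mem_ball_zero_iff.2 hw.1, hw.2⟩

/-- For a point `t z`, `1 - t z` is a convex combination of `1` and `1 - z`, and the slit plane is
star-shaped about `1`. Only `t = 0` reaches the boundary of the disc about `1`. -/
theorem segment_subset_discUnion {z : ℂ} (hz : z ∈ cutDisc) : segment ℝ 0 z ⊆ discUnion := by
  rw [mem_cutDisc] at hz
  rintro _ ⟨s, t, hs, ht, hst, rfl⟩
  rw [smul_zero, zero_add]
  rcases ht.eq_or_lt with rfl | ht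
  · left
    simp
  · right
    have e : 1 - t • z = s • (1 : ℂ) + t • (1 - z) := by
      have : (s : ℂ) + t = 1 := by rw [← ofReal_add, hst, ofReal_one]
      simp only [real_smul]
      linear_combination -this
    rw [mem_cutDisc, e]
    refine ⟨?_, starConvex_one_slitPlane hz.2 hs ht.le hst⟩
    calc _ ≤ ‖s • (1 : ℂ)‖ + ‖t • (1 - z)‖ := norm_add_le _ _
      _ = s + t * ‖1 - z‖ := by
        rw [norm_smul, norm_smul, Real.norm_of_nonneg hs, Real.norm_of_nonneg ht.le, norm_one,
          mul_one]
      _ < 1 := by nlinarith [hz.1]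

/-- The power series with coefficients `c` continues analytically to `discUnion`. -/
def Continues (c : ℕ → ℂ) : Prop :=
  ∃ F : ℂ → ℂ, DifferentiableOn ℂ F discUnion ∧ ∀ w, ‖w‖ < 1 → F w = ps c w

-- The series and `H` are glued along the overlap of their domains, which lies in the lens.
open Classical in
theorem SubExp.exists_continuation {c : ℕ → ℂ} (hc : SubExp c) {H : ℂ → ℂ}
    (hH : DifferentiableOn ℂ H cutDisc) (h : ∀ w ∈ lens, ps c w = H w) :
    ∃ F : ℂ → ℂ, DifferentiableOn ℂ F discUnion ∧ (∀ w, ‖w‖ < 1 → F w = ps c w)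
      ∧ ∀ w ∈ cutDisc, F w = H w := by
  have hF2 : ∀ w ∈ cutDisc, (if ‖w‖ < 1 then ps c w else H w) = H w := fun w hw => by
    split_ifs with h1
    · exact h w (mem_lens.2 ⟨h1, (mem_cutDisc.1 hw).1⟩)
    · rfl
  refine ⟨fun w => if ‖w‖ < 1 then ps c w else H w, ?_, fun w hw => if_pos hw, hF2⟩
  refine DifferentiableOn.union_of_isOpen (hc.differentiableOn.congr fun w hw =>
    if_pos (mem_ball_zero_iff.1 hw)) (hH.congr hF2) Metric.isOpen_ball isOpen_cutDisc

theorem exists_continuation_gaussCoef {a b : ℂ} (m : ℕ) (ha : NotPole (a + m)) (hb : NotPole b) :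
    ∃ F : ℂ → ℂ, DifferentiableOn ℂ F discUnion
      ∧ (∀ w, ‖w‖ < 1 → F w = ps (gaussCoef a b (a + b + m)) w)
      ∧ ∀ w ∈ cutDisc, F w = connection a b m (1 - w) := by
  refine (subExp_gaussCoef a _ hb).exists_continuation (H := fun w => connection a b m (1 - w))
    ((differentiableOn_connection m ha hb).comp (by fun_prop)
      fun w hw => one_sub_mem_of_mem_cutDisc hw) fun w hw => ?_
  have := connection_formula m ha hb (1 - w) (one_sub_mem_lens hw)
  rwa [sub_sub_cancel] at this

namespace Continues

variable {c : ℕ → ℂ}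

theorem const_mul (hc : Continues c) (a : ℂ) : Continues fun k => a * c k := by
  obtain ⟨F, hF, h⟩ := hc
  exact ⟨fun w => a * F w, hF.const_mul a, fun w hw => by
    beta_reduce; rw [h w hw, ps_const_mul]⟩

theorem shift (hs : SubExp c) (hc : Continues c) : Continues fun k => c (k + 1) := by
  obtain ⟨F, hF, h⟩ := hc
  have h0 : discUnion ∈ 𝓝 (0 : ℂ) := isOpen_discUnion.mem_nhds (Or.inl (by simp))
  have hF0 : F 0 = c 0 := by rw [h 0 (by simp), hs.ps_eq_add (by simp)]; ring
  -- Dropping the constant term and dividing by `w` is the slope of `F` at `0`, whose singularity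
  -- there is removable.
  refine ⟨dslope F 0, (Complex.differentiableOn_dslope h0).2 hF, fun w hw => ?_⟩
  by_cases hw0 : w = 0
  · have he : F =ᶠ[𝓝 0] ps c := Filter.eventually_of_mem
      (Metric.isOpen_ball.mem_nhds (Metric.mem_ball_self one_pos))
      fun w hw => h w (mem_ball_zero_iff.1 hw)
    rw [hw0, dslope_same, he.deriv_eq, (hs.hasDerivAt (by simp)).deriv,
      hs.dcoef.ps_eq_add (by simp), hs.shift.ps_eq_add (by simp)]
    simp [dcoef]
  · rw [dslope_of_ne _ hw0, slope_def_field, h w hw, hF0, hs.ps_eq_add hw, sub_zero]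
    field_simp
    ring

theorem shift_add (hs : SubExp c) (hc : Continues c) (N : ℕ) :
    SubExp (fun k => c (N + k)) ∧ Continues fun k => c (N + k) := by
  induction N with
  | zero => simpa using ⟨hs, hc⟩
  | succ N ih =>
    have e : (fun k => c (N + 1 + k)) = fun k => c (N + (k + 1)) := by
      ext k; congr 1; omega
    rw [e]
    exact ⟨ih.1.shift, shift ih.1 ih.2⟩

theorem sum {ι : Type*} (S : Finset ι) {c : ι → ℕ → ℂ} (hs : ∀ i ∈ S, SubExp (c i))
    (hc : ∀ i ∈ S, Continues (c i)) : Continues fun k => ∑ i ∈ S, c i k := by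
  choose! F hF h using hc
  refine ⟨fun w => ∑ i ∈ S, F i w, DifferentiableOn.fun_sum hF, fun w hw => ?_⟩
  simp only [ps, Finset.sum_mul]
  rw [Summable.tsum_finsetSum fun i hi => (hs i hi).summable hw]
  exact Finset.sum_congr rfl fun i hi => h i hi w hw

end Continues

/-! ### Partial fractions. -/

/-- These are the coefficients for `₂F₁(1, s; 1 + s; z)`, a case of the connection formula with `m =
0`. -/
theorem NotPole.continues_inv {s : ℂ} (hs : NotPole s) :
    SubExp (fun k => (s + k)⁻¹) ∧ Continues fun k => (s + k)⁻¹ := by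
  have e : gaussCoef 1 s (1 + s + (0 : ℕ)) = fun k : ℕ => (s + k)⁻¹ := by
    ext k
    have h1 := hs.add_natCast_ne_zero k
    have h2 := cast_factorial_ne_zero k
    have h3 := (hs.add_natCast k).Gamma_ne_zero
    rw [gaussCoef, poch_one, Nat.cast_zero, add_zero, show 1 + s + (k : ℂ) = s + k + 1 by ring,
      Gamma_add_one _ h1]
    field_simp
  rw [← e]
  refine ⟨subExp_gaussCoef _ _ hs, ?_⟩
  obtain ⟨F, h1, h2, -⟩ := exists_continuation_gaussCoef (a := 1) 0
    (by simpa using NotPole.one) hs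
  exact ⟨F, h1, h2⟩

/-- Series whose coefficients are reciprocals of products of distinct linear factors. -/
theorem continues_prod_inv {ι : Type*} [DecidableEq ι] {S : Finset ι} (hS : S.Nonempty) {v : ι → ℂ}
    (hv : ∀ i ∈ S, NotPole (v i)) (hinj : Set.InjOn v S) :
    Continues fun k : ℕ => ∏ i ∈ S, (v i + k)⁻¹ := by
  have e : (fun k : ℕ => ∏ i ∈ S, (v i + k)⁻¹)
      = fun k : ℕ => ∑ i ∈ S, Lagrange.nodalWeight S (fun i => -v i) i * (v i + k)⁻¹ := by
    ext k
    -- Lagrange interpolation of the constant `1` at the nodes `-v i`, evaluated at `k`, is the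
    -- partial fraction expansion.
    have h := Lagrange.eval_interpolate_not_at_node (s := S) (v := fun i => -v i) (fun _ => 1)
      (x := (k : ℂ)) (fun i hi e => (hv i hi).add_natCast_ne_zero k (by rw [e]; ring))
    have h1 : Lagrange.interpolate S (fun i => -v i) (fun _ => (1 : ℂ)) = 1 :=
      Lagrange.interpolate_one (fun i hi j hj e => hinj hi hj (neg_injective e)) hS
    rw [h1, Polynomial.eval_one, Lagrange.eval_nodal] at h
    simp only [sub_neg_eq_add, mul_one, add_comm (k : ℂ)] at h
    rw [Finset.prod_inv_distrib]
    exact (eq_inv_of_mul_eq_one_right h.symm).symm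
  rw [e]
  exact Continues.sum S (fun i hi => (hv i hi).continues_inv.1.const_mul _)
    fun i hi => (hv i hi).continues_inv.2.const_mul _

/-! ### The `₃F₂` as a tail of the Gauss series. -/

theorem pow_mul_ps_shift {c : ℕ → ℂ} (hc : SubExp c) (N : ℕ) {z : ℂ} (hz : ‖z‖ < 1) :
    z ^ N * ps (fun k => c (N + k)) z = ps c z - ∑ k ∈ Finset.range N, c k * z ^ k := by
  rw [ps, ps, ← (hc.summable hz).sum_add_tsum_nat_add N, add_sub_cancel_left, ← tsum_mul_left]
  refine tsum_congr fun k => ?_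
  rw [add_comm k N, pow_add]
  ring

/-- Coefficients of `₃F₂(β, ν, 1; δ, N + 1; z)`. -/
noncomputable def hypCoef (β ν δ : ℂ) (N k : ℕ) : ℂ :=
  poch β k * poch ν k / (poch δ k * poch (N + 1) k)

theorem hyp3F2Series_eq_ps (β ν δ : ℂ) (N : ℕ) :
    hyp3F2Series β ν 1 δ ((N + 1 : ℕ) : ℂ) = ps (hypCoef β ν δ N) := by
  ext z
  refine tsum_congr fun k => ?_
  have := cast_factorial_ne_zero k
  rw [hypCoef, poch_one]
  push_cast
  field_simp

/-- The source of the `₃F₂`: the shift turns `(N + k)!` into `N! (N + 1)_k`, and the numerator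
parameter `1` cancels the `k!` of the hypergeometric series. -/
theorem gaussCoef_add (a b c : ℂ) (N k : ℕ) (hb : NotPole (b + N)) (hc : NotPole (c + N)) :
    gaussCoef a b c (N + k) = Gamma (b + N) * poch a N / (Gamma (c + N) * N.factorial)
      * hypCoef (b + N) (a + N) (c + N) N k := by
  have h1 := hb.Gamma_add_natCast k
  have h2 := hc.Gamma_add_natCast k
  have h3 := hc.Gamma_ne_zero
  have h4 := hc.poch_ne_zero k
  have h5 := cast_factorial_ne_zero N
  have h6 := (NotPole.natCast_add_one N).poch_ne_zero k
  have h7 : ((N + k).factorial : ℂ) = N.factorial * poch (N + 1) k := by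
    rw [← poch_one, poch_add, poch_one, add_comm (1 : ℂ)]
  rw [gaussCoef, hypCoef, Nat.cast_add, ← add_assoc, ← add_assoc, h1, h2, poch_add, h7]
  field_simp

/-- Both quotients of Pochhammer symbols collapse, `(β)_k / (β+t)_k = (β)_t / (β+k)_t` and likewise
for `i`, leaving reciprocals of finitely many linear factors in `k`. -/
theorem continues_hypCoef_of_nat {β : ℂ} (N t i : ℕ) (hi : 1 ≤ i) (hiN : i ≤ N)
    (hβ : NotPole (β - N)) : Continues (hypCoef β i (β + t) N) := by
  obtain ⟨r, rfl⟩ := Nat.exists_eq_add_of_le hiN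
  set v : ℕ → ℂ := fun j => if j < t then β + j else (i + (j - t) : ℕ) with hv
  have hβ' : NotPole β := by simpa using hβ.add_natCast (i + r)
  have hi' : NotPole (i : ℂ) := NotPole.of_re_pos (by
    simp only [natCast_re, Nat.cast_pos]; omega)
  have e : hypCoef β i (β + t) (i + r) = fun k : ℕ => poch β t * poch i (r + 1)
      * ∏ j ∈ Finset.range (t + (r + 1)), (v j + k)⁻¹ := by
    ext k
    have h1 : poch β t * poch (β + t) k = poch β k * poch (β + k) t := by
      rw [← poch_add, ← poch_add, add_comm]
    have h2 : poch (i : ℂ) (r + 1) * poch (((i + r : ℕ) : ℂ) + 1) k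
        = poch (i : ℂ) k * poch ((i : ℂ) + k) (r + 1) := by
      have := poch_add (i : ℂ) (r + 1) k
      rw [add_comm, poch_add] at this
      rw [this]
      congr 2
      push_cast
      ring
    have h3 : ∏ j ∈ Finset.range (t + (r + 1)), (v j + k)⁻¹
        = (poch (β + k) t)⁻¹ * (poch ((i : ℂ) + k) (r + 1))⁻¹ := by
      rw [Finset.prod_range_add, poch_eq_prod, poch_eq_prod, ← Finset.prod_inv_distrib,
        ← Finset.prod_inv_distrib]
      congr 1
      · refine Finset.prod_congr rfl fun j hj => ?_
        rw [hv]
        simp only [Finset.mem_range.1 hj, ↓reduceIte]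
        rw [add_right_comm]
      · refine Finset.prod_congr rfl fun j _ => ?_
        rw [hv]
        simp only [add_lt_iff_neg_left, not_lt_zero, ↓reduceIte, Nat.add_sub_cancel_left]
        push_cast
        rw [add_right_comm]
    have n1 := (hβ'.add_natCast k).poch_ne_zero t
    have n2 := (hi'.add_natCast k).poch_ne_zero (r + 1)
    have n3 := (hβ'.add_natCast t).poch_ne_zero k
    have n4 := (NotPole.natCast_add_one (i + r)).poch_ne_zero k
    rw [hypCoef, h3]
    field_simp
    linear_combination (-poch (i : ℂ) k * poch ((i : ℂ) + k) (r + 1)) * h1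
      - poch β t * poch (β + t) k * h2
  rw [e]
  refine (continues_prod_inv (S := Finset.range (t + (r + 1))) ⟨0, by simp⟩ (v := v)
    (fun j _ => ?_) ?_).const_mul _
  · rw [hv]
    simp only []
    split_ifs with h
    · exact hβ'.add_natCast j
    · rw [Nat.cast_add]
      exact hi'.add_natCast _
  -- A coincidence between the two families of nodes would make `β - N` a nonpositive integer.
  · have key : ∀ j j' : ℕ, j' < r + 1 → β + j ≠ (i + j' : ℕ) := fun j j' hj' e => by
      refine hβ (j + (r - j')) ?_
      push_cast [Nat.cast_sub (Nat.lt_succ_iff.1 hj')] at e ⊢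
      linear_combination e
    intro j hj j' hj' e
    rw [Finset.coe_range, Set.mem_Iio] at hj hj'
    rw [hv] at e
    simp only [] at e
    split_ifs at e with h h' h'
    · exact_mod_cast add_left_cancel e
    · exact absurd e (key _ _ (by omega))
    · exact absurd e.symm (key _ _ (by omega))
    · have := Nat.cast_injective (R := ℂ) e
      omega

/-- If `(a)_N ≠ 0`, a tail of the Gauss series can be divided by its constant factor. If `(a)_N =
0`, the tail is identically zero and says nothing about the `₃F₂`, so partial fractions take over.
-/
theorem continues_hypCoef {a b : ℂ} (m N : ℕ) (ha : NotPole (a + m)) (hb : NotPole b)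
    (hc : NotPole (a + b + m + N)) :
    Continues (hypCoef (b + N) (a + N) (a + b + m + N) N) := by
  by_cases h : poch a N = 0
  · obtain ⟨j, hj, hja⟩ := Finset.prod_eq_zero_iff.1 (poch_eq_prod a N ▸ h)
    rw [Finset.mem_range] at hj
    have haj : a = -(j : ℂ) := eq_neg_of_add_eq_zero_left hja
    -- Otherwise `a + m = -(j - m)` would be a pole; this makes `c + N` exceed `b + N` by the
    -- natural number `m - j`.
    have hmj : j < m := by
      by_contra hmj
      refine ha (j - m) ?_
      rw [haj, Nat.cast_sub (not_lt.1 hmj)]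
      ring
    have := continues_hypCoef_of_nat (β := b + N) N (m - j) (N - j) (by omega) (by omega)
      (by simpa using hb)
    convert this using 2
    · rw [haj, Nat.cast_sub hj.le]
      ring
    · rw [haj, Nat.cast_sub hmj.le]
      ring
  · obtain ⟨F, h1, h2, -⟩ := exists_continuation_gaussCoef m ha hb
    have hs := (Continues.shift_add (subExp_gaussCoef a (a + b + m) hb) ⟨F, h1, h2⟩ N).2
    have hC : Gamma (b + N) * poch a N / (Gamma (a + b + m + N) * N.factorial) ≠ 0 :=
      div_ne_zero (mul_ne_zero (hb.add_natCast N).Gamma_ne_zero h)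
        (mul_ne_zero hc.Gamma_ne_zero (cast_factorial_ne_zero N))
    convert hs.const_mul (Gamma (b + N) * poch a N / (Gamma (a + b + m + N) * N.factorial))⁻¹
      using 1
    ext k
    rw [gaussCoef_add _ _ _ _ _ (hb.add_natCast N) hc, inv_mul_cancel_left₀ hC]

theorem exists_continuesHyp3F2 {a b : ℂ} (m N : ℕ) (ha : NotPole (a + m)) (hb : NotPole b)
    (hc : NotPole (a + b + m + N)) {z : ℂ} (hz : z ∈ cutDisc) :
    ∃ F, ContinuesHyp3F2 (b + N) (a + N) 1 (a + b + m + N) ((N + 1 : ℕ) : ℂ) z F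
      ∧ Gamma (b + N) * poch a N / (Gamma (a + b + m + N) * N.factorial) * z ^ N * F z
        = connection a b m (1 - z)
          - ∑ k ∈ Finset.range N, gaussCoef a b (a + b + m) k * z ^ k := by
  obtain ⟨F, hF, hF1⟩ := continues_hypCoef m N ha hb hc
  obtain ⟨E, hE, hE1, hE2⟩ := exists_continuation_gaussCoef m ha hb
  have hsub := segment_subset_discUnion hz
  have aF := (hF.analyticOnNhd isOpen_discUnion).mono hsub
  have aE := (hE.analyticOnNhd isOpen_discUnion).mono hsub
  have hball : ∀ᶠ w : ℂ in 𝓝 0, ‖w‖ < 1 := Filter.eventually_of_mem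
    (Metric.isOpen_ball.mem_nhds (Metric.mem_ball_self one_pos)) fun w hw => mem_ball_zero_iff.1 hw
  refine ⟨F, ⟨aF, ?_⟩, ?_⟩
  · rw [hyp3F2Series_eq_ps]
    exact hball.mono hF1
  · rw [← hE2 z hz]
    have a1 : AnalyticOnNhd ℂ (fun w => Gamma (b + N) * poch a N
        / (Gamma (a + b + m + N) * N.factorial) * w ^ N * F w) (segment ℝ 0 z) :=
      (analyticOnNhd_const.mul (analyticOnNhd_id.pow N)).mul aF
    have a2 : AnalyticOnNhd ℂ (fun w => E w
        - ∑ k ∈ Finset.range N, gaussCoef a b (a + b + m) k * w ^ k) (segment ℝ 0 z) :=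
      aE.sub (Finset.analyticOnNhd_fun_sum _ fun k _ =>
        analyticOnNhd_const.mul (analyticOnNhd_id.pow k))
    -- Near `0` the relation is the index shift of the series; analyticity of both sides on the
    -- segment carries it to `z`.
    refine a1.eqOn_of_preconnected_of_eventuallyEq a2 (convex_segment (0 : ℂ) z).isPreconnected
      (left_mem_segment ℝ 0 z) ?_ (right_mem_segment ℝ 0 z)
    filter_upwards [hball] with w hw
    rw [hE1 w hw, hF1 w hw, ← pow_mul_ps_shift (subExp_gaussCoef a _ hb) N hw, mul_right_comm,
      ← ps_const_mul, mul_comm]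
    congr 2
    ext k
    rw [gaussCoef_add _ _ _ _ _ (hb.add_natCast N) hc]

/-! ### Re-expansion of the removed terms and the final formula. -/

/-- Binomial expansion of `((z - 1) + 1) ^ k` and interchange of the two finite sums. -/
theorem sum_gaussCoef_eq (a b c : ℂ) (N : ℕ) (z : ℂ) :
    ∑ k ∈ Finset.range N, gaussCoef a b c k * z ^ k
      = ∑ l ∈ Finset.range N, (∑ k ∈ Finset.Icc l (N - 1), poch a k * Gamma (b + k)
        / (Gamma (c + k) * ((k - l).factorial : ℂ))) * (z - 1) ^ l / (l.factorial : ℂ) := by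
  have h : ∀ k ∈ Finset.range N, gaussCoef a b c k * z ^ k
      = ∑ l ∈ Finset.range (k + 1), poch a k * Gamma (b + k)
        / (Gamma (c + k) * ((k - l).factorial : ℂ)) * (z - 1) ^ l / (l.factorial : ℂ) := by
    intro k _
    have e : z ^ k = ((z - 1) + 1) ^ k := by rw [sub_add_cancel]
    rw [e, add_pow, Finset.mul_sum]
    refine Finset.sum_congr rfl fun l hl => ?_
    have hlk : l ≤ k := Nat.lt_succ_iff.1 (Finset.mem_range.1 hl)
    rw [Nat.cast_choose ℂ hlk, gaussCoef, one_pow, mul_one]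
    have h1 := cast_factorial_ne_zero k
    field_simp
  rw [Finset.sum_congr rfl h, Finset.sum_comm' (t' := Finset.range N)
    (s' := fun l => Finset.Icc l (N - 1))]
  · refine Finset.sum_congr rfl fun l _ => ?_
    rw [Finset.sum_mul, Finset.sum_div]
  · intro k l
    simp only [Finset.mem_range, Finset.mem_Icc]
    omega

theorem mem_cutDisc_of_arg {z : ℂ} (hz : ‖1 - z‖ < 1) (hz1 : z ≠ 1)
    (harg : |arg (1 - z)| < Real.pi) : z ∈ cutDisc :=
  mem_cutDisc.2 ⟨hz, mem_slitPlane_iff_arg.2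
    ⟨fun h => absurd harg (by rw [h, abs_of_pos Real.pi_pos]; exact lt_irrefl _),
      sub_ne_zero.2 hz1.symm⟩⟩

theorem hasSum_logPart {p q : ℂ} (hp : NotPole p) (hq : NotPole q) (m : ℕ) {w : ℂ}
    (hw : ‖w‖ < 1) :
    HasSum (fun k : ℕ => logCoef p q m k * w ^ k * (log w + digammaCoef p q m k))
      (log w * ps (logCoef p q m) w + ps (fun k => logCoef p q m k * digammaCoef p q m k) w) :=
  ((((subExp_logCoef p q m).hasSum hw).mul_left _).add
    ((subExp_logCoef_mul_digammaCoef hp hq m).hasSum hw)).congr_fun fun k => by ring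

theorem hyp3F2_transformation (n m : ℕ) (hn : 1 ≤ n) (hm : 1 ≤ m) (β ν σ : ℂ)
    (hσm : (n : ℂ) + σ - ν = (m : ℂ))
    (hν : ν ≠ (n : ℂ))
    (hσ : ∀ j : ℕ, σ ≠ -(j : ℂ))
    (hβ : ∀ j : ℕ, β ≠ (n : ℂ) - 1 - (j : ℂ))
    (hβσ : ∀ j : ℕ, β + σ ≠ -(j : ℂ))
    (z : ℂ) (hz : z ∈ cutDisc) :
    (∃ F : ℂ → ℂ, ContinuesHyp3F2 β ν 1 (β + σ) (n : ℂ) z F) ∧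
    (Summable fun k : ℕ =>
      poch σ k * poch (β + σ - ν) k / (((k + m - 1).factorial : ℂ) * (k.factorial : ℂ))
        * (1 - z) ^ k
        * (Complex.log (1 - z) - digamma (σ - ν + n + k) + digamma (σ + k)
            + digamma (k + β + σ - ν) - digamma (k + 1))) ∧
    (Gamma β * poch (ν - n) n / (Gamma (β + σ) * (ν - n) * ((n - 1).factorial : ℂ))
        * z ^ (n - 1) * hyp3F2 β ν 1 (β + σ) (n : ℂ) z
      = 1 / (Gamma σ * Gamma (β + σ - ν))
          * ∑ k ∈ Finset.range (m - 1),
              (-1) ^ k / (k.factorial : ℂ) * Gamma (k + β - n + 1) * poch (1 + ν - n) k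
                * ((m - 2 - k).factorial : ℂ) * (1 - z) ^ k
        + (-1) ^ m / Gamma (ν - n + 1) * (1 - z) ^ (m - 1)
          * ∑' k : ℕ,
              poch σ k * poch (β + σ - ν) k / (((k + m - 1).factorial : ℂ) * (k.factorial : ℂ))
                * (1 - z) ^ k
                * (Complex.log (1 - z) - digamma (σ - ν + n + k) + digamma (σ + k)
                    + digamma (k + β + σ - ν) - digamma (k + 1))
        - ∑ l ∈ Finset.range (n - 1),
            (∑ k ∈ Finset.Icc l (n - 2),
              poch (ν - n + 1) k * Gamma (k - n + β + 1)
                / (Gamma (k - n + β + σ + 1) * ((k - l).factorial : ℂ)))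
              * (z - 1) ^ l / (l.factorial : ℂ)) := by
  obtain ⟨N, rfl⟩ := Nat.exists_eq_add_of_le' hn
  obtain ⟨M, rfl⟩ := Nat.exists_eq_add_of_le' hm
  simp only [Nat.cast_add, Nat.cast_one] at hσm hν hβ ⊢
  have hνσ : ν = N + σ - M := by linear_combination -hσm
  have eM : ν - N + M = σ := by rw [hνσ]; ring
  have eq : β - N + M = β + σ - ν := by rw [hνσ]; ring
  have ec : ν - N + (β - N) + M + N = β + σ := by rw [hνσ]; ring
  have hb : NotPole (β - N) := fun j e => hβ j (by linear_combination e)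
  have ha : NotPole (ν - N + M) := by rw [eM]; exact hσ
  have hc : NotPole (ν - N + (β - N) + M + N) := by rw [ec]; exact hβσ
  have hq : NotPole (β - N + M) := hb.add_natCast M
  obtain ⟨F, hF, hE⟩ := exists_continuesHyp3F2 M N ha hb hc hz
  rw [ec, sub_add_cancel] at hE
  rw [ec, sub_add_cancel, sub_add_cancel, Nat.cast_add, Nat.cast_one] at hF
  have hw := (mem_cutDisc.1 hz).1
  have hS := hasSum_logPart ha hq M hw
  have hT : ∀ k : ℕ, poch σ k * poch (β + σ - ν) k
      / (((k + (M + 1) - 1).factorial : ℂ) * (k.factorial : ℂ)) * (1 - z) ^ k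
      * (Complex.log (1 - z) - digamma (σ - ν + (N + 1) + k) + digamma (σ + k)
        + digamma (k + β + σ - ν) - digamma (k + 1))
      = logCoef (ν - N + M) (β - N + M) M k * (1 - z) ^ k
        * (log (1 - z) + digammaCoef (ν - N + M) (β - N + M) M k) := by
    intro k
    rw [logCoef, digammaCoef, eM, eq, show σ - ν + (N + 1) + k = (M : ℂ) + 1 + k by rw [hνσ]; ring,
      show (k : ℂ) + β + σ - ν = β + σ - ν + k by ring, add_comm (k : ℂ) 1]
    simp only [Nat.add_succ_sub_one]
    ring
  refine ⟨⟨F, hF⟩, ?_, ?_⟩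
  · simp only [hT]
    exact hS.summable
  · rw [hyp3F2_eq_of_continues hF]
    simp only [hT]
    rw [hS.tsum_eq]
    -- Cancelling `ν - n`, which is where `ν ≠ n` enters, leaves `(ν - N)_N = (a)_N`.
    have h1 : Gamma β * poch (ν - (N + 1)) (N + 1)
        / (Gamma (β + σ) * (ν - (N + 1)) * ((N + 1 - 1).factorial : ℂ)) * z ^ (N + 1 - 1) * F z
        = Gamma β * poch (ν - N) N / (Gamma (β + σ) * N.factorial) * z ^ N * F z := by
      have : ν - (N + 1) ≠ 0 := sub_ne_zero.2 hν
      rw [poch_succ_left, Nat.add_sub_cancel, show ν - (N + 1 : ℂ) + 1 = ν - N by ring]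
      congr 2
      field_simp
    have h2 : ∑ k ∈ Finset.range (M + 1 - 1),
        (-1) ^ k / (k.factorial : ℂ) * Gamma (k + β - (N + 1) + 1) * poch (1 + ν - (N + 1)) k
          * ((M + 1 - 2 - k).factorial : ℂ) * (1 - z) ^ k
        = finPart (ν - N) (β - N) M (1 - z) := by
      rw [finPart, Nat.add_sub_cancel]
      refine Finset.sum_congr rfl fun k _ => ?_
      rw [show (k : ℂ) + β - (N + 1) + 1 = β - N + k by ring,
        show 1 + ν - (N + 1 : ℂ) = ν - N by ring, show M + 1 - 2 - k = M - 1 - k by omega]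
    have h3 : ∑ l ∈ Finset.range (N + 1 - 1), (∑ k ∈ Finset.Icc l (N + 1 - 2),
        poch (ν - (N + 1) + 1) k * Gamma (k - (N + 1) + β + 1)
          / (Gamma (k - (N + 1) + β + σ + 1) * ((k - l).factorial : ℂ)))
          * (z - 1) ^ l / (l.factorial : ℂ)
        = ∑ k ∈ Finset.range N, gaussCoef (ν - N) (β - N) (ν - N + (β - N) + M) k * z ^ k := by
      rw [sum_gaussCoef_eq, Nat.add_sub_cancel]
      refine Finset.sum_congr rfl fun l _ => ?_
      congr 2
      refine Finset.sum_congr (by congr 1) fun k _ => ?_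
      rw [show ν - (N + 1 : ℂ) + 1 = ν - N by ring,
        show (k : ℂ) - (N + 1) + β + 1 = β - N + k by ring,
        show (k : ℂ) - (N + 1) + β + σ + 1 = ν - N + (β - N) + M + k by rw [hνσ]; ring]
    rw [h1, h2, h3, hE, connection, logPart, eM, eq, show ν - (N + 1 : ℂ) + 1 = ν - N by ring,
      Nat.add_sub_cancel]
    ring

theorem mainTheorem2 (n m : ℕ) (hn : 1 ≤ n) (hm : 1 ≤ m) (β ν σ : ℂ)
    (hσm : (n : ℂ) + σ - ν = (m : ℂ))
    (hν : ν ≠ (n : ℂ))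
    (hσ : ∀ j : ℕ, σ ≠ -(j : ℂ))
    (hβ : ∀ j : ℕ, β ≠ (n : ℂ) - 1 - (j : ℂ))
    (hβσ : ∀ j : ℕ, β + σ ≠ -(j : ℂ))
    (z : ℂ) (hz : ‖1 - z‖ < 1) (hz1 : z ≠ 1) (harg : |Complex.arg (1 - z)| < Real.pi) :
    -- the hypergeometric function on the left is defined at `z`
    (∃ F : ℂ → ℂ, ContinuesHyp3F2 β ν 1 (β + σ) (n : ℂ) z F) ∧
    -- the infinite series on the right converges absolutely
    (Summable fun k : ℕ =>
      poch σ k * poch (β + σ - ν) k / (((k + m - 1).factorial : ℂ) * (k.factorial : ℂ))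
        * (1 - z) ^ k
        * (Complex.log (1 - z) - digamma (σ - ν + n + k) + digamma (σ + k)
            + digamma (k + β + σ - ν) - digamma (k + 1))) ∧
    -- the transformation equation
    (Gamma β * poch (ν - n) n / (Gamma (β + σ) * (ν - n) * ((n - 1).factorial : ℂ))
        * z ^ (n - 1) * hyp3F2 β ν 1 (β + σ) (n : ℂ) z
      = 1 / (Gamma σ * Gamma (β + σ - ν))
          * ∑ k ∈ Finset.range (m - 1),
              (-1) ^ k / (k.factorial : ℂ) * Gamma (k + β - n + 1) * poch (1 + ν - n) k
                * ((m - 2 - k).factorial : ℂ) * (1 - z) ^ k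
        + (-1) ^ m / Gamma (ν - n + 1) * (1 - z) ^ (m - 1)
          * ∑' k : ℕ,
              poch σ k * poch (β + σ - ν) k / (((k + m - 1).factorial : ℂ) * (k.factorial : ℂ))
                * (1 - z) ^ k
                * (Complex.log (1 - z) - digamma (σ - ν + n + k) + digamma (σ + k)
                    + digamma (k + β + σ - ν) - digamma (k + 1))
        - ∑ l ∈ Finset.range (n - 1),
            (∑ k ∈ Finset.Icc l (n - 2),
              poch (ν - n + 1) k * Gamma (k - n + β + 1)
                / (Gamma (k - n + β + σ + 1) * ((k - l).factorial : ℂ)))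
              * (z - 1) ^ l / (l.factorial : ℂ)) ∧
    -- the same equation with `σ` eliminated
    (Gamma β * poch (ν - n) n / (Gamma (β + m - n + ν) * (ν - n) * ((n - 1).factorial : ℂ))
        * z ^ (n - 1) * hyp3F2 β ν 1 (β + m - n + ν) (n : ℂ) z
      = 1 / (Gamma (m - n + ν) * Gamma (β + m - n))
          * ∑ k ∈ Finset.range (m - 1),
              (-1) ^ k / (k.factorial : ℂ) * Gamma (k + β - n + 1) * poch (1 + ν - n) k
                * ((m - 2 - k).factorial : ℂ) * (1 - z) ^ k
        + (-1) ^ m / Gamma (ν - n + 1) * (1 - z) ^ (m - 1)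
          * ∑' k : ℕ,
              poch (m - n + ν) k * poch (β + m - n) k
                / (((k + m - 1).factorial : ℂ) * (k.factorial : ℂ))
                * (1 - z) ^ k
                * (Complex.log (1 - z) - digamma (m + k) + digamma (m - n + ν + k)
                    + digamma (k + β + m - n) - digamma (k + 1))
        - ∑ l ∈ Finset.range (n - 1),
            (∑ k ∈ Finset.Icc l (n - 2),
              poch (ν - n + 1) k * Gamma (k - n + β + 1)
                / (Gamma (k - 2 * n + β + m + ν + 1) * ((k - l).factorial : ℂ)))
              * (z - 1) ^ l / (l.factorial : ℂ)) := by
  have hz' := mem_cutDisc_of_arg hz hz1 harg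
  obtain ⟨h1, h2, h3⟩ := hyp3F2_transformation n m hn hm β ν σ hσm hν hσ hβ hβσ z hz'
  refine ⟨h1, h2, h3, ?_⟩
  have hσ' : (m : ℂ) - n + ν = σ := by linear_combination -hσm
  have e2 : β + m - n = β + σ - ν := by rw [← hσ']; ring
  have e3 : ∀ k : ℕ, (m : ℂ) + k = σ - ν + n + k := fun k => by rw [← hσ']; ring
  have e4 : ∀ k : ℕ, (k : ℂ) + β + m - n = k + β + σ - ν := fun k => by rw [← hσ']; ring
  have e5 : ∀ k : ℕ, (k : ℂ) - 2 * n + β + m + ν + 1 = k - n + β + σ + 1 := fun k => by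
    rw [← hσ']; ring
  simp only [hσ', e2, sub_add_cancel, e3, e4, e5]
  exact h3
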